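/- Fix $\alpha\in(-1,1)$. There exist constants $c_0>0$ and $\beta>1$, depending only on $\alpha$, such that the following holds. Let $Z=(X,Y)\colon\mathbf{R}\to\mathbf{R}^2$ be a two-sided (bi-infinite) Brownian motion with $Z_0=0$ and $$\operatorname{Var}(X_t)=\operatorname{Var}(Y_t)=|t|,\qquad \operatorname{Cov}(X_t,Y_t)=\alpha|t|\qquad (t\in\mathbf{R});$$ that is, $Z$ has almost surely continuous paths and independent increments, and for $s\le t$ the increment $Z_t-Z_s$ is a centred Gaussian vector with covariance matrix $(t-s)\begin{pmatrix}1&\alpha\\ \alpha&1\end{pmatrix}$. The restriction of $Z$ to a time interval $[s,t]$ is called a $\pi/2$-cone excursion if $X_r\ge X_s$ and $Y_r\ge Y_s$ for all $r\in[s,t]$, and $X_s=X_t$ or $Y_s=Y_t$; its starting time is $s$, its length is $t-s$, and its terminal displacement is $\max(X_t-X_s,\,Y_t-Y_s)$. For each integer $k\ge 0$ let $E_k$ be the event that $Z$ has a $\pi/2$-cone excursion with starting time in $[-k-1,-k]$, length at least $k+1$, and terminal displacement at most $1$. Then $$\mathbf{P}[E_k]\le c_0\,k^{-\beta}\qquad\text{for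 every integer } k\ge 1.$$ In particular, almost surely only finitely many of the events $E_k$ occur. -/

import Mathlib

open MeasureTheory ProbabilityTheory Set

/-- A two-sided planar Brownian motion `Z = (X, Y)`, with time set `ℝ`, started from
`Z₀ = 0`, whose coordinates are normalized by `Var X_t = Var Y_t = |t|` and
`Cov(X_t, Y_t) = α |t|`: it has independent increments over all of `ℝ`, the increment over `[s, t]`
is a centred Gaussian vector with covariance matrix `(t - s) • !![1, α; α, 1]`, and almost every
path is continuous. (For `-1 < α < 1` this matrix is positive definite.) -/
structure IsTwoSidedCorrelatedBrownian {Ω : Type*} [MeasurableSpace Ω] (α : ℝ)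
    (Z : ℝ → Ω → EuclideanSpace ℝ (Fin 2)) (P : Measure Ω) : Prop where
  zero : ∀ᵐ ω ∂P, Z 0 ω = 0
  indepIncrements : HasIndepIncrements Z P
  hasLaw_sub : ∀ s t : ℝ, s ≤ t →
    HasLaw (fun ω => Z t ω - Z s ω)
      (multivariateGaussian 0 ((t - s) • !![1, α; α, 1])) P
  continuous_paths : ∀ᵐ ω ∂P, Continuous (fun t => Z t ω)

/-- The restriction of the path `z = (x, y)` to the time interval `[s, t]` is a `π/2`-cone
excursion: `z r ≥ z s` coordinatewise for all `r ∈ [s, t]`, and `x s = x t` or `y s = y t`. -/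
def IsConeExcursion (z : ℝ → EuclideanSpace ℝ (Fin 2)) (s t : ℝ) : Prop :=
  s ≤ t ∧ (∀ r ∈ Icc s t, z s 0 ≤ z r 0 ∧ z s 1 ≤ z r 1) ∧ (z s 0 = z t 0 ∨ z s 1 = z t 1)

/-- The terminal displacement `max (x t - x s, y t - y s)` of `z = (x, y)` over `[s, t]`. -/
noncomputable def terminalDisplacement (z : ℝ → EuclideanSpace ℝ (Fin 2)) (s t : ℝ) : ℝ :=
  max (z t 0 - z s 0) (z t 1 - z s 1)

/-- The event that `Z` has a `π/2`-cone excursion which starts in `[-k-1, -k]`, has length at least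
`k + 1`, and has terminal displacement at most `1`. -/
def largeConeExcursionEvent {Ω : Type*} (Z : ℝ → Ω → EuclideanSpace ℝ (Fin 2)) (k : ℕ) : Set Ω :=
  {ω | ∃ s t : ℝ, s ∈ Icc (-(k : ℝ) - 1) (-(k : ℝ)) ∧ IsConeExcursion (fun r => Z r ω) s t ∧
    (k : ℝ) + 1 ≤ t - s ∧ terminalDisplacement (fun r => Z r ω) s t ≤ 1}

/-! In the coordinates `u = x + y`, `v = x - y` the two components are independent Brownian motions
with variances `a = 2(1 + α)` and `b = 2(1 - α)`, and the quadrant becomes `{|v| ≤ u}`. After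
whitening, this cone has opening angle less than `π`, so a path stays in it up to time `N` with
probability at most of order `N ^ (-(1 + ε) / 2)` for some `ε > 0`: strictly better than the
half-plane exponent `1/2`. This gain is what makes `β > 1`.

An excursion with terminal displacement at most `1` is seen as a cone path from both ends: forwards
from its start, and, since `Z s` is at least `Z t - 1` coordinatewise, backwards from its end, up to
an error. If it runs from near `-k` to near `n` and `m = k + n`, the first and last thirds are
independent and each costs about `m ^ (-(1 + ε) / 2)`. The middle increment must then bring the
endpoints close together, which costs a planar Gaussian density of order `1 / m`. The product is
about `m ^ (-(2 + ε))`, and summing over `n` leaves an exponent above `1` in `k`.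

The survival bound comes from an explicit weight that is superharmonic for the walk sampled at
integer times (`exists_coneWeight_drift`, `measure_survivalSet_le`). The two ends and the middle are
combined in `exists_measure_coneBridge_le`. Passing from real to integer endpoints costs an
oscillation of size `h` (`mem_coneBridge_of_isConeExcursion`); taking `h` a small power of `m` makes
larger oscillations negligible (`exists_measure_largeOscillation_le`) and loses only part of `ε`. -/

open scoped ENNReal NNReal

/-! ### The weight on the cone and its pointwise expansion -/

/-- A function which is superharmonic far from the apex of the cone `{|v| ≤ u}`, homogeneous of
degree `1 + ε` and comparable with `u ^ (1 + ε)` there. -/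
noncomputable def coneWeight (ε : ℝ) (z : ℝ × ℝ) : ℝ :=
  z.1 ^ (1 + ε) - z.2 ^ 2 / 2 * z.1 ^ (ε - 1)

/-- The part of the cone `{|v| ≤ u}` with `H ≤ u`. -/
def truncatedCone (H : ℝ) : Set (ℝ × ℝ) := {z | H ≤ z.1 ∧ |z.2| ≤ z.1}

lemma measurable_coneWeight (ε : ℝ) : Measurable (coneWeight ε) := by
  unfold coneWeight; fun_prop

lemma measurableSet_truncatedCone (H : ℝ) : MeasurableSet (truncatedCone H) := by
  apply IsClosed.measurableSet
  exact (isClosed_le continuous_const continuous_fst).inter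
    (isClosed_le (continuous_snd.abs) continuous_fst)

lemma half_rpow_le_coneWeight {ε : ℝ} {z : ℝ × ℝ} (hz : 0 < z.1) (h : |z.2| ≤ z.1) :
    z.1 ^ (1 + ε) / 2 ≤ coneWeight ε z := by
  have h1 : z.1 ^ (1 + ε) = z.1 ^ 2 * z.1 ^ (ε - 1) := by
    rw [← Real.rpow_natCast, ← Real.rpow_add hz]; congr 1; push_cast; ring
  have h2 : z.2 ^ 2 ≤ z.1 ^ 2 :=
    sq_le_sq' (by linarith [neg_abs_le z.2]) (by linarith [le_abs_self z.2])
  have h3 : 0 < z.1 ^ (ε - 1) := Real.rpow_pos_of_pos hz _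
  rw [coneWeight, h1]
  nlinarith

lemma coneWeight_nonneg {ε : ℝ} {z : ℝ × ℝ} (hz : 0 < z.1) (h : |z.2| ≤ z.1) :
    0 ≤ coneWeight ε z :=
  le_trans (by positivity) (half_rpow_le_coneWeight hz h)

/-- `coneWeight` lies below its expansion around `(u, v)`. -/
lemma coneWeight_add_le {ε u v x y : ℝ} (hε0 : 0 ≤ ε) (hε1 : ε ≤ 1) (hu : 0 < u)
    (hux : 0 < u + x) :
    coneWeight ε (u + x, v + y) ≤ u ^ (ε - 1) *
      ((u + x) * (u + ε * x) - (v + y) ^ 2 / 2 * (1 - (1 - ε) * (x / u))) := by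
  have ha : -1 < x / u := by rw [lt_div_iff₀ hu]; linarith
  have h1a : 0 < 1 + x / u := by linarith
  have hfac : u + x = u * (1 + x / u) := by field_simp
  have hU : 0 < u ^ (ε - 1) := Real.rpow_pos_of_pos hu _
  -- Both powers are controlled by Bernoulli's inequality for exponents in `[0, 1]`, applied to `ε`
  -- here and to `1 - ε` below.
  have e1 : (u + x) ^ (1 + ε) ≤ u ^ (ε - 1) * ((u + x) * (u + ε * x)) := by
    have b := rpow_one_add_le_one_add_mul_self ha.le hε0 hε1
    have : (u + x) ^ (1 + ε) = (u + x) * (u * u ^ (ε - 1) * (1 + x / u) ^ ε) := by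
      rw [Real.rpow_add hux, Real.rpow_one]
      congr 1
      nth_rw 1 [hfac]
      rw [Real.mul_rpow hu.le h1a.le]
      congr 1
      rw [Real.rpow_sub_one hu.ne']; field_simp
    rw [this]
    have h2 : u * (1 + ε * (x / u)) = u + ε * x := by field_simp
    calc _ ≤ (u + x) * (u * u ^ (ε - 1) * (1 + ε * (x / u))) := by gcongr
      _ = u ^ (ε - 1) * ((u + x) * (u * (1 + ε * (x / u)))) := by ring
      _ = _ := by rw [h2]
  have e2 : u ^ (ε - 1) * (1 - (1 - ε) * (x / u)) ≤ (u + x) ^ (ε - 1) := by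
    rw [hfac, Real.mul_rpow hu.le h1a.le]
    gcongr
    have b := rpow_one_add_le_one_add_mul_self ha.le (p := 1 - ε) (by linarith) (by linarith)
    have : (1 + x / u) ^ (ε - 1) = ((1 + x / u) ^ (1 - ε))⁻¹ := by
      rw [← Real.rpow_neg h1a.le]; congr 1; ring
    rw [this]
    have hp : 0 < (1 + x / u) ^ (1 - ε) := Real.rpow_pos_of_pos h1a _
    rw [← one_div, le_div_iff₀ hp]
    rcases le_total (1 - (1 - ε) * (x / u)) 0 with h | h
    · nlinarith
    · nlinarith [mul_le_mul_of_nonneg_left b h, sq_nonneg ((1 - ε) * (x / u))]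
  rw [coneWeight]
  have := mul_le_mul_of_nonneg_left e2 (show 0 ≤ (v + y) ^ 2 / 2 by positivity)
  simp only
  nlinarith

/-- The killed weight is zero outside the cone, so it is dominated there only by a nonnegative
function. The expansion can be negative for large steps; the quartic term repairs this, and its mean
is only `O(1 / u)`. -/
lemma cone_expansion_add_quartic_nonneg {ε u v x y : ℝ} (hε0 : 0 ≤ ε) (hε1 : ε ≤ 1) (hu : 1 ≤ u)
    (hv : |v| ≤ u) :
    0 ≤ (u + x) * (u + ε * x) - (v + y) ^ 2 / 2 * (1 - (1 - ε) * (x / u))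
      + 1000000 * (x ^ 4 + y ^ 4) / u := by
  have hu0 : 0 < u := by linarith
  obtain ⟨a, rfl⟩ : ∃ a, x = u * a := ⟨x / u, by field_simp⟩
  obtain ⟨b, rfl⟩ : ∃ b, y = u * b := ⟨y / u, by field_simp⟩
  obtain ⟨c, rfl⟩ : ∃ c, v = u * c := ⟨v / u, by field_simp⟩
  have hc : |c| ≤ 1 := by
    rw [abs_mul, abs_of_pos hu0] at hv
    nlinarith
  have e1 : u * a / u = a := by field_simp
  have e2 : 1000000 * ((u * a) ^ 4 + (u * b) ^ 4) / u = u ^ 2 * (1000000 * u * (a ^ 4 + b ^ 4)) := by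
    field_simp
  rw [e1, e2]
  have key : 0 ≤ (1 + a) * (1 + ε * a) - (c + b) ^ 2 / 2 * (1 - (1 - ε) * a)
      + 1000000 * (a ^ 4 + b ^ 4) := by
    obtain ⟨hc1, hc2⟩ := abs_le.1 hc
    -- For small steps the main term alone is positive, since `0.81 > 0.6655`. Otherwise the quartic
    -- term is at least `100` and dominates everything else.
    by_cases h : |a| ≤ 1 / 10 ∧ |b| ≤ 1 / 10
    · obtain ⟨ha1, ha2⟩ := abs_le.1 h.1
      obtain ⟨hb1, hb2⟩ := abs_le.1 h.2
      have q1 : (9 / 10) * (9 / 10) ≤ (1 + a) * (1 + ε * a) := by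
        apply mul_le_mul <;> nlinarith
      have q2 : (c + b) ^ 2 / 2 * (1 - (1 - ε) * a) ≤ (121 / 200) * (11 / 10) := by
        apply mul_le_mul <;> nlinarith
      have : 0 ≤ a ^ 4 + b ^ 4 := by positivity
      linarith
    · have hbig : 1 / 10000 ≤ a ^ 4 + b ^ 4 := by
        have aux : ∀ s : ℝ, 1 / 10 < |s| → 1 / 10000 ≤ s ^ 4 := by
          intro s hs
          have : (1 / 10 : ℝ) ^ 4 ≤ |s| ^ 4 := by gcongr
          rw [Even.pow_abs (by decide)] at this
          norm_num at this ⊢; linarith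
        rcases not_and_or.1 h with h | h
        · have := aux a (not_le.1 h); have : 0 ≤ b ^ 4 := by positivity
          linarith
        · have := aux b (not_le.1 h); have : 0 ≤ a ^ 4 := by positivity
          linarith
      have p1 : -(2 + 2 * a ^ 2) ≤ (1 + a) * (1 + ε * a) := by
        nlinarith [sq_nonneg (a + 1), sq_nonneg (a - 1), mul_nonneg hε0 (sq_nonneg a)]
      have p2 : (c + b) ^ 2 / 2 ≤ 1 + b ^ 2 := by nlinarith [sq_nonneg (c - b)]
      have p3 : 1 - (1 - ε) * a ≤ 2 + a ^ 2 := by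
        nlinarith [sq_nonneg (a + 1), sq_nonneg (a - 1), mul_nonneg hε0 (sq_nonneg a),
          mul_nonneg hε0 (sq_nonneg (a - 1)), mul_nonneg hε0 (sq_nonneg (a + 1)),
          mul_nonneg (sub_nonneg.2 hε1) (sq_nonneg (a + 1))]
      have p4 : (c + b) ^ 2 / 2 * (1 - (1 - ε) * a) ≤ (1 + b ^ 2) * (2 + a ^ 2) := by
        calc _ ≤ (c + b) ^ 2 / 2 * (2 + a ^ 2) := by gcongr
          _ ≤ _ := by gcongr
      nlinarith [sq_nonneg (a ^ 2 - 1), sq_nonneg (b ^ 2 - 1), sq_nonneg (a ^ 2 - b ^ 2)]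
  have h4 : 0 ≤ a ^ 4 + b ^ 4 := by positivity
  have : 1000000 * (a ^ 4 + b ^ 4) ≤ 1000000 * u * (a ^ 4 + b ^ 4) := by nlinarith
  have e3 : (u + u * a) * (u + ε * (u * a)) - (u * c + u * b) ^ 2 / 2 * (1 - (1 - ε) * a) +
      u ^ 2 * (1000000 * u * (a ^ 4 + b ^ 4)) = u ^ 2 * ((1 + a) * (1 + ε * a)
      - (c + b) ^ 2 / 2 * (1 - (1 - ε) * a) + 1000000 * u * (a ^ 4 + b ^ 4)) := by ring
  rw [e3]
  apply mul_nonneg (by positivity)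
  linarith

/-! ### Gaussian moments and the one-step drift -/

lemma integrable_pow_gaussianReal (a : ℝ≥0) (n : ℕ) :
    Integrable (fun x : ℝ => x ^ n) (gaussianReal 0 a) := by
  rcases Nat.eq_zero_or_pos n with rfl | hn
  · simp
  have h := (memLp_id_gaussianReal (μ := 0) (v := a) (n : ℝ≥0)).integrable_norm_pow (by omega)
  refine h.mono (by fun_prop) (Filter.Eventually.of_forall fun x => ?_)
  simp

lemma integral_sq_gaussianReal (a : ℝ≥0) : ∫ x : ℝ, x ^ 2 ∂(gaussianReal 0 a) = a := by
  have := variance_id_gaussianReal (μ := 0) (v := a)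
  rw [variance_eq_integral (by fun_prop)] at this
  simpa using this

/-- The law of the increments of the walk in the coordinates in which the covariance is diagonal. -/
noncomputable def stepLaw (a b : ℝ≥0) : Measure (ℝ × ℝ) :=
  (gaussianReal 0 a).prod (gaussianReal 0 b)

instance (a b : ℝ≥0) : IsProbabilityMeasure (stepLaw a b) := by
  unfold stepLaw; infer_instance

lemma integrable_cone_expansion (a b : ℝ≥0) (ε u v C : ℝ) :
    Integrable (fun z : ℝ × ℝ => (u + z.1) * (u + ε * z.1)
      - (v + z.2) ^ 2 / 2 * (1 - (1 - ε) * (z.1 / u)) + C * (z.1 ^ 4 + z.2 ^ 4) / u)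
      (stepLaw a b) ∧
    ∫ z, ((u + z.1) * (u + ε * z.1)
      - (v + z.2) ^ 2 / 2 * (1 - (1 - ε) * (z.1 / u)) + C * (z.1 ^ 4 + z.2 ^ 4) / u)
      ∂(stepLaw a b) = u ^ 2 + ε * a - (v ^ 2 + b) / 2 +
        C * ((∫ x, x ^ 4 ∂(gaussianReal 0 a)) + ∫ x, x ^ 4 ∂(gaussianReal 0 b)) / u := by
  have i1 : ∀ c, Integrable (fun x : ℝ => x) (gaussianReal 0 c) := fun c => by
    simpa using integrable_pow_gaussianReal c 1
  have i2 := fun c => integrable_pow_gaussianReal c 2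
  have i4 := fun c => integrable_pow_gaussianReal c 4
  have m1 : ∀ c, ∫ x : ℝ, x ∂(gaussianReal 0 c) = 0 := fun c => integral_id_gaussianReal
  have m2 := integral_sq_gaussianReal
  have hf : Integrable (fun x : ℝ => (u + x) * (u + ε * x)) (gaussianReal 0 a) ∧
      ∫ x : ℝ, (u + x) * (u + ε * x) ∂(gaussianReal 0 a) = u ^ 2 + ε * a := by
    have e : (fun x : ℝ => (u + x) * (u + ε * x)) =
        fun x => u ^ 2 + ((1 + ε) * u * x + ε * x ^ 2) := by ext; ring
    rw [e]
    have j1 := ((i1 a).const_mul ((1 + ε) * u))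
    have j2 := ((i2 a).const_mul ε)
    refine ⟨(integrable_const _).add (j1.add j2), ?_⟩
    have j3 : Integrable (fun x : ℝ => (1 + ε) * u * x + ε * x ^ 2) (gaussianReal 0 a) := j1.add j2
    rw [integral_add (integrable_const _) j3, integral_add j1 j2, integral_const_mul,
      integral_const_mul, m1, m2]
    simp
  have hg : Integrable (fun y : ℝ => (v + y) ^ 2 / 2) (gaussianReal 0 b) ∧
      ∫ y : ℝ, (v + y) ^ 2 / 2 ∂(gaussianReal 0 b) = (v ^ 2 + b) / 2 := by
    have e : (fun y : ℝ => (v + y) ^ 2 / 2) =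
        fun y => v ^ 2 / 2 + (v * y + (1 / 2) * y ^ 2) := by ext; ring
    rw [e]
    have j1 := ((i1 b).const_mul v)
    have j2 := ((i2 b).const_mul (1 / 2))
    refine ⟨(integrable_const _).add (j1.add j2), ?_⟩
    have j3 : Integrable (fun x : ℝ => v * x + (1 / 2) * x ^ 2) (gaussianReal 0 b) := j1.add j2
    rw [integral_add (integrable_const _) j3, integral_add j1 j2, integral_const_mul,
      integral_const_mul, m1, m2]
    simp; ring
  have hk : Integrable (fun x : ℝ => 1 - (1 - ε) * (x / u)) (gaussianReal 0 a) ∧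
      ∫ x : ℝ, (1 - (1 - ε) * (x / u)) ∂(gaussianReal 0 a) = 1 := by
    have j := ((i1 a).div_const u).const_mul (1 - ε)
    refine ⟨(integrable_const _).sub j, ?_⟩
    rw [integral_sub (integrable_const _) j, integral_const_mul, integral_div, m1]
    simp
  have I1 : Integrable (fun z : ℝ × ℝ => (u + z.1) * (u + ε * z.1)) (stepLaw a b) :=
    hf.1.comp_fst _
  have I2 : Integrable (fun z : ℝ × ℝ => (v + z.2) ^ 2 / 2 * (1 - (1 - ε) * (z.1 / u)))
      (stepLaw a b) := by
    refine (hk.1.mul_prod hg.1).congr (Filter.Eventually.of_forall fun z => ?_)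
    simp only; ring
  have I3 : Integrable (fun z : ℝ × ℝ => z.1 ^ 4) (stepLaw a b) := (i4 a).comp_fst _
  have I4 : Integrable (fun z : ℝ × ℝ => z.2 ^ 4) (stepLaw a b) := (i4 b).comp_snd _
  have I5 : Integrable (fun z : ℝ × ℝ => C * (z.1 ^ 4 + z.2 ^ 4) / u) (stepLaw a b) :=
    ((I3.add I4).const_mul C).div_const u
  refine ⟨(I1.sub I2).add I5, ?_⟩
  have I12 : Integrable (fun z : ℝ × ℝ => (u + z.1) * (u + ε * z.1)
      - (v + z.2) ^ 2 / 2 * (1 - (1 - ε) * (z.1 / u))) (stepLaw a b) := I1.sub I2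
  rw [integral_add I12 I5, integral_sub I1 I2, integral_div, integral_const_mul,
    integral_add I3 I4]
  have E1 : ∫ z : ℝ × ℝ, (u + z.1) * (u + ε * z.1) ∂(stepLaw a b) = u ^ 2 + ε * a := by
    rw [stepLaw, integral_fun_fst (fun x : ℝ => (u + x) * (u + ε * x)), hf.2]; simp
  have E2 : ∫ z : ℝ × ℝ, (v + z.2) ^ 2 / 2 * (1 - (1 - ε) * (z.1 / u)) ∂(stepLaw a b)
      = (v ^ 2 + b) / 2 := by
    simp_rw [mul_comm (_ / (2 : ℝ))]
    rw [stepLaw, integral_prod_mul (fun x : ℝ => 1 - (1 - ε) * (x / u))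
      (fun y : ℝ => (v + y) ^ 2 / 2), hk.2, hg.2, one_mul]
  have E3 : ∫ z : ℝ × ℝ, z.1 ^ 4 ∂(stepLaw a b) = ∫ x, x ^ 4 ∂(gaussianReal 0 a) := by
    rw [stepLaw, integral_fun_fst (fun x : ℝ => x ^ 4)]; simp
  have E4 : ∫ z : ℝ × ℝ, z.2 ^ 4 ∂(stepLaw a b) = ∫ x, x ^ 4 ∂(gaussianReal 0 b) := by
    rw [stepLaw, integral_fun_snd (fun x : ℝ => x ^ 4)]; simp
  rw [E1, E2, E3, E4]

/-- One-step drift inequality: `coneWeight` is strictly superharmonic for the Gaussian walk killed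
when leaving the truncated cone. -/
lemma exists_coneWeight_drift {a b : ℝ≥0} (hb : 0 < b) {ε : ℝ} (hε0 : 0 < ε) (hε1 : ε ≤ 1)
    (hε : ε * a ≤ b / 4) :
    ∃ H₀ c : ℝ, 1 ≤ H₀ ∧ 0 < c ∧ ∀ H, H₀ ≤ H → ∀ z ∈ truncatedCone H,
      ∫⁻ x, (truncatedCone H).indicator (fun y => ENNReal.ofReal (coneWeight ε y)) (z + x)
        ∂(stepLaw a b) + ENNReal.ofReal (c * z.1 ^ (ε - 1)) ≤ ENNReal.ofReal (coneWeight ε z) := by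
  set M := (∫ x, x ^ 4 ∂(gaussianReal 0 a)) + ∫ x, x ^ 4 ∂(gaussianReal 0 b) with hM
  have hM0 : 0 ≤ M := add_nonneg (integral_nonneg fun x => by positivity)
    (integral_nonneg fun x => by positivity)
  have hb' : (0 : ℝ) < b := by exact_mod_cast hb
  -- The mean second-order term is `ε * a - b / 2 ≤ -b / 4`. This `H₀` keeps the quartic correction
  -- below `b / 8`, leaving a drift of `-b / 8`.
  refine ⟨max 1 (8 * (1000000 * M) / b), b / 8, le_max_left _ _, by positivity, ?_⟩
  rintro H hH ⟨u, v⟩ ⟨hHu, huv⟩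
  simp only at hHu huv
  have hu1 : 1 ≤ u := (le_max_left _ _).trans (hH.trans hHu)
  have hu0 : 0 < u := by linarith
  have hH0 : 0 < H := lt_of_lt_of_le one_pos ((le_max_left _ _).trans hH)
  have huM : 1000000 * M / u ≤ b / 8 := by
    have := (le_max_right _ _).trans (hH.trans hHu)
    rw [div_le_iff₀ hb'] at this
    rw [div_le_iff₀ hu0]
    linarith
  have hU : 0 < u ^ (ε - 1) := Real.rpow_pos_of_pos hu0 _
  obtain ⟨hint, hval⟩ := integrable_cone_expansion a b ε u v 1000000
  have hnn := fun z : ℝ × ℝ => cone_expansion_add_quartic_nonneg (x := z.1) (y := z.2)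
    hε0.le hε1 hu1 huv
  have step : ∫⁻ x, (truncatedCone H).indicator (fun y => ENNReal.ofReal (coneWeight ε y))
      ((u, v) + x) ∂(stepLaw a b) ≤ ENNReal.ofReal (u ^ (ε - 1) *
        (u ^ 2 + ε * a - (v ^ 2 + b) / 2 + 1000000 * M / u)) := by
    rw [hM, ← hval, ← integral_const_mul, ofReal_integral_eq_lintegral_ofReal
      (hint.const_mul _) (Filter.Eventually.of_forall fun z => mul_nonneg hU.le (hnn z))]
    refine lintegral_mono fun z => ?_
    by_cases hz : (u, v) + z ∈ truncatedCone H
    · rw [indicator_of_mem hz]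
      refine ENNReal.ofReal_le_ofReal ?_
      have h0 : 0 < u + z.1 := lt_of_lt_of_le hH0 hz.1
      refine (coneWeight_add_le hε0.le hε1 hu0 h0).trans ?_
      gcongr
      have : 0 ≤ 1000000 * (z.1 ^ 4 + z.2 ^ 4) / u := by positivity
      linarith
    · rw [indicator_of_notMem hz]; exact zero_le
  have hw : coneWeight ε (u, v) = u ^ (ε - 1) * (u ^ 2 - v ^ 2 / 2) := by
    have h1 : u ^ (1 + ε) = u ^ 2 * u ^ (ε - 1) := by
      rw [← Real.rpow_natCast, ← Real.rpow_add hu0]; congr 1; push_cast; ring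
    rw [coneWeight, h1]; ring
  refine (add_le_add_left step _).trans ?_
  by_cases hpos : 0 ≤ u ^ (ε - 1) * (u ^ 2 + ε * a - (v ^ 2 + b) / 2 + 1000000 * M / u)
  · rw [← ENNReal.ofReal_add hpos (by positivity)]
    apply ENNReal.ofReal_le_ofReal
    rw [hw]
    simp only
    nlinarith
  · exfalso
    apply hpos
    rw [← hval]
    exact mul_nonneg hU.le (integral_nonneg hnn)

/-! ### Survival of the killed walk -/

/-- The position at time `n` of the walk started at `z` with steps `x`. -/
def walkPos (z : ℝ × ℝ) (x : ℕ → ℝ × ℝ) (n : ℕ) : ℝ × ℝ := z + ∑ i ∈ Finset.range n, x i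

/-- The step sequences for which the walk started at `z` stays in `D` up to time `n`. -/
def survivalSet (D : Set (ℝ × ℝ)) (z : ℝ × ℝ) (n : ℕ) : Set (ℕ → ℝ × ℝ) :=
  {x | ∀ i ≤ n, walkPos z x i ∈ D}

lemma walkPos_succ (z : ℝ × ℝ) (x : ℕ → ℝ × ℝ) (n : ℕ) :
    walkPos z x (n + 1) = walkPos z x n + x n := by
  simp [walkPos, Finset.sum_range_succ, add_assoc]

lemma walkPos_congr {z : ℝ × ℝ} {x y : ℕ → ℝ × ℝ} {n : ℕ} (h : ∀ i < n, x i = y i) :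
    walkPos z x n = walkPos z y n := by
  simp only [walkPos]
  rw [Finset.sum_congr rfl fun i hi => h i (Finset.mem_range.1 hi)]

lemma mem_survivalSet_congr {D : Set (ℝ × ℝ)} {z : ℝ × ℝ} {x y : ℕ → ℝ × ℝ} {n : ℕ}
    (h : ∀ i < n, x i = y i) : x ∈ survivalSet D z n ↔ y ∈ survivalSet D z n := by
  simp only [survivalSet, mem_ofPred_eq]
  refine forall₂_congr fun i hi => ?_
  rw [walkPos_congr fun j hj => h j (hj.trans_le hi)]

lemma mem_survivalSet_succ {D : Set (ℝ × ℝ)} {z : ℝ × ℝ} {x : ℕ → ℝ × ℝ} {n : ℕ} :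
    x ∈ survivalSet D z (n + 1) ↔ x ∈ survivalSet D z n ∧ walkPos z x n + x n ∈ D := by
  rw [← walkPos_succ]
  simp only [survivalSet, mem_ofPred_eq]
  constructor
  · exact fun h => ⟨fun i hi => h i (by omega), h _ le_rfl⟩
  · rintro ⟨h1, h2⟩ i hi
    rcases Nat.lt_or_ge i (n + 1) with h | h
    · exact h1 i (by omega)
    · obtain rfl : i = n + 1 := by omega
      exact h2

lemma measurable_walkPos (z : ℝ × ℝ) (n : ℕ) : Measurable (fun x => walkPos z x n) := by
  unfold walkPos; fun_prop

lemma measurableSet_survivalSet {D : Set (ℝ × ℝ)} (hD : MeasurableSet D) (z : ℝ × ℝ) (n : ℕ) :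
    MeasurableSet (survivalSet D z n) := by
  simp only [survivalSet, ofPred_forall]
  exact MeasurableSet.iInter fun i => MeasurableSet.iInter fun _ => measurable_walkPos z i hD

section

variable {Ω : Type*} [MeasurableSpace Ω] {P : Measure Ω} [IsProbabilityMeasure P]
  {ν : Measure (ℝ × ℝ)} [IsProbabilityMeasure ν] {ξ : ℕ → Ω → ℝ × ℝ}

/-- Markov property of the killed walk. -/
lemma lintegral_survivalSet_succ (hξ : ∀ i, Measurable (ξ i)) {n : ℕ}
    (hind : IndepFun (fun ω (i : Fin n) => ξ i ω) (ξ n) P) (hlaw : P.map (ξ n) = ν)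
    {D : Set (ℝ × ℝ)} (hD : MeasurableSet D) (z : ℝ × ℝ) {f : ℝ × ℝ → ℝ≥0∞} (hf : Measurable f) :
    ∫⁻ ω, (survivalSet D z (n + 1)).indicator (fun x => f (walkPos z x (n + 1)))
        (fun i => ξ i ω) ∂P =
      ∫⁻ ω, (survivalSet D z n).indicator
        (fun x => ∫⁻ e, D.indicator f (walkPos z x n + e) ∂ν) (fun i => ξ i ω) ∂P := by
  -- Padding the first `n` steps by zeros makes survival and position at time `n` functions of the
  -- past alone, so the independence of step `n` turns the expectation into an iterated integral.
  let ext : (Fin n → ℝ × ℝ) → ℕ → ℝ × ℝ := fun y i => if h : i < n then y ⟨i, h⟩ else 0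
  have hext : Measurable ext := by
    refine measurable_pi_lambda _ fun i => ?_
    by_cases h : i < n
    · simpa [ext, h] using measurable_pi_apply _
    · simp [ext, h]
  let Y : Ω → Fin n → ℝ × ℝ := fun ω i => ξ i ω
  have hY : Measurable Y := measurable_pi_lambda _ fun i => hξ i
  have hagree : ∀ ω, ∀ i < n, ext (Y ω) i = ξ i ω := fun ω i hi => by simp [ext, Y, hi]
  let G : (Fin n → ℝ × ℝ) × (ℝ × ℝ) → ℝ≥0∞ := fun p =>
    (survivalSet D z n).indicator (fun x => D.indicator f (walkPos z x n + p.2)) (ext p.1)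
  have hG : Measurable G := by
    have : G = (Prod.fst ⁻¹' (ext ⁻¹' survivalSet D z n)).indicator
        (fun p => D.indicator f (walkPos z (ext p.1) n + p.2)) := by
      ext p
      by_cases h : ext p.1 ∈ survivalSet D z n
      · rw [indicator_of_mem (by exact h)]; simp only [G]; rw [indicator_of_mem h]
      · rw [indicator_of_notMem (by exact h)]; simp only [G]; rw [indicator_of_notMem h]
    rw [this]
    refine Measurable.indicator ?_ (measurable_fst (hext (measurableSet_survivalSet hD z n)))
    exact (hf.indicator hD).comp
      (((measurable_walkPos z n).comp (hext.comp measurable_fst)).add measurable_snd)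
  have h1 : ∀ ω, (survivalSet D z (n + 1)).indicator (fun x => f (walkPos z x (n + 1)))
      (fun i => ξ i ω) = G (Y ω, ξ n ω) := by
    intro ω
    simp only [G]
    by_cases h : (fun i => ξ i ω) ∈ survivalSet D z n
    · rw [indicator_of_mem ((mem_survivalSet_congr (hagree ω)).2 h), walkPos_congr (hagree ω)]
      by_cases h' : walkPos z (fun i => ξ i ω) n + ξ n ω ∈ D
      · rw [indicator_of_mem h', indicator_of_mem (mem_survivalSet_succ.2 ⟨h, h'⟩), walkPos_succ]
      · rw [indicator_of_notMem h', indicator_of_notMem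
          fun hc => h' (mem_survivalSet_succ.1 hc).2]
    · rw [indicator_of_notMem fun hc => h (mem_survivalSet_succ.1 hc).1,
        indicator_of_notMem fun hc => h ((mem_survivalSet_congr (hagree ω)).1 hc)]
  have h2 : ∀ ω, (survivalSet D z n).indicator
      (fun x => ∫⁻ e, D.indicator f (walkPos z x n + e) ∂ν) (fun i => ξ i ω) =
      ∫⁻ e, G (Y ω, e) ∂ν := by
    intro ω
    simp only [G]
    by_cases h : (fun i => ξ i ω) ∈ survivalSet D z n
    · rw [indicator_of_mem h]
      simp_rw [indicator_of_mem ((mem_survivalSet_congr (hagree ω)).2 h),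
        walkPos_congr (hagree ω)]
    · rw [indicator_of_notMem h]
      simp_rw [indicator_of_notMem fun hc => h ((mem_survivalSet_congr (hagree ω)).1 hc)]
      simp
  simp_rw [h1, h2]
  have hmap : P.map (fun ω => (Y ω, ξ n ω)) = (P.map Y).prod ν := by
    rw [← hlaw]
    exact (indepFun_iff_map_prod_eq_prod_map_map hY.aemeasurable (hξ n).aemeasurable).1 hind
  rw [← lintegral_map (f := G) hG (hY.prodMk (hξ n)), hmap, lintegral_prod _ hG.aemeasurable,
    lintegral_map hG.lintegral_prod_right' hY]

lemma sum_add_le_of_add_le {a f : ℕ → ℝ≥0∞} {N : ℕ} (h : ∀ j < N, a (j + 1) + f j ≤ a j) :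
    ∀ n ≤ N, a n + ∑ j ∈ Finset.range n, f j ≤ a 0 := by
  intro n
  induction n with
  | zero => simp
  | succ n ih =>
    intro hn
    rw [Finset.sum_range_succ]
    calc _ = (a (n + 1) + f n) + ∑ j ∈ Finset.range n, f j := by ring
      _ ≤ a n + ∑ j ∈ Finset.range n, f j := by gcongr; exact h n (by omega)
      _ ≤ _ := ih (by omega)

/-- Survival probability of the walk in the truncated cone. -/
lemma measure_survivalSet_le {ε c H : ℝ} (hε0 : 0 < ε) (hε1 : ε ≤ 1) (hc : 0 < c) (hH : 1 ≤ H)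
    (hdrift : ∀ z ∈ truncatedCone H,
      ∫⁻ x, (truncatedCone H).indicator (fun y => ENNReal.ofReal (coneWeight ε y)) (z + x) ∂ν +
        ENNReal.ofReal (c * z.1 ^ (ε - 1)) ≤ ENNReal.ofReal (coneWeight ε z))
    (hξ : ∀ i, Measurable (ξ i)) {N : ℕ} (hN : 1 ≤ N)
    (hind : ∀ n < N, IndepFun (fun ω (i : Fin n) => ξ i ω) (ξ n) P)
    (hlaw : ∀ n < N, P.map (ξ n) = ν) {z : ℝ × ℝ} :
    P {ω | (fun i => ξ i ω) ∈ survivalSet (truncatedCone H) z N} ≤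
      ENNReal.ofReal ((2 + 1 / c) * (N : ℝ) ^ (-((1 + ε) / 2))) *
        ENNReal.ofReal (coneWeight ε z) := by
  set D := truncatedCone H
  have hD : MeasurableSet D := measurableSet_truncatedCone H
  have hN0 : (0 : ℝ) < N := by exact_mod_cast hN
  have hx : Measurable (fun ω i => ξ i ω) := measurable_pi_lambda _ hξ
  by_cases hz : z ∈ D
  swap
  · have : {ω | (fun i => ξ i ω) ∈ survivalSet D z N} = ∅ := by
      ext ω
      simp only [mem_ofPred_eq, mem_empty_iff_false, iff_false]
      intro h
      exact hz (by simpa [walkPos] using h 0 (Nat.zero_le _))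
    rw [this]; simp
  -- `a j` is the expected weight of the walk alive at time `j`, and `f j` the expected loss at the
  -- next step.
  let a : ℕ → ℝ≥0∞ := fun j => ∫⁻ ω, (survivalSet D z j).indicator
    (fun x => ENNReal.ofReal (coneWeight ε (walkPos z x j))) (fun i => ξ i ω) ∂P
  let f : ℕ → ℝ≥0∞ := fun j => ∫⁻ ω, (survivalSet D z j).indicator
    (fun x => ENNReal.ofReal (c * (walkPos z x j).1 ^ (ε - 1))) (fun i => ξ i ω) ∂P
  have ha0 : a 0 ≤ ENNReal.ofReal (coneWeight ε z) := by
    calc a 0 ≤ ∫⁻ ω, ENNReal.ofReal (coneWeight ε z) ∂P := by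
          refine lintegral_mono fun ω => ?_
          refine (indicator_le_self _ _ _).trans ?_
          simp [walkPos]
      _ = _ := by simp
  have hmw : Measurable fun y => ENNReal.ofReal (coneWeight ε y) :=
    (measurable_coneWeight ε).ennreal_ofReal
  have hmS : ∀ j, MeasurableSet (survivalSet D z j) := measurableSet_survivalSet hD z
  have hma : ∀ j, Measurable fun ω => (survivalSet D z j).indicator
      (fun x => ENNReal.ofReal (coneWeight ε (walkPos z x j))) (fun i => ξ i ω) := fun j =>
    ((hmw.comp (measurable_walkPos z j)).indicator (hmS j)).comp hx
  have hmf : ∀ j, Measurable fun ω => (survivalSet D z j).indicator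
      (fun x => ENNReal.ofReal (c * (walkPos z x j).1 ^ (ε - 1))) (fun i => ξ i ω) := fun j => by
    refine Measurable.comp (Measurable.indicator ?_ (hmS j)) hx
    have := measurable_walkPos z j
    fun_prop
  have hrec : ∀ j < N, a (j + 1) + f j ≤ a j := by
    intro j hj
    simp only [a]
    rw [lintegral_survivalSet_succ hξ (hind j hj) (hlaw j hj) hD z hmw]
    simp only [f]
    rw [← lintegral_add_right _ (hmf j)]
    refine lintegral_mono fun ω => ?_
    by_cases h : (fun i => ξ i ω) ∈ survivalSet D z j
    · simp only [indicator_of_mem h]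
      exact hdrift _ (h j le_rfl)
    · simp [indicator_of_notMem h]
  have hsum := sum_add_le_of_add_le hrec
  set q := (1 + ε) / 2 with hq
  set K₁ := ENNReal.ofReal (2 * (N : ℝ) ^ (-q))
  set K₂ := ENNReal.ofReal ((N : ℝ) ^ (1 - q) / c)
  set p := P {ω | (fun i => ξ i ω) ∈ survivalSet D z N}
  -- A walk alive at time `N` is alive at `j`. If its height is then at least `√N`, the weight is at
  -- least `N ^ q / 2`; if it is at most `√N`, the loss is at least `c * N ^ (q - 1)`, because `ε -
  -- 1 ≤ 0`.
  have hp : ∀ j < N, p ≤ K₁ * a j + K₂ * f j := by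
    intro j hj
    have hmeas : MeasurableSet {ω | (fun i => ξ i ω) ∈ survivalSet D z N} := hx (hmS N)
    simp only [a, f]
    rw [← lintegral_const_mul _ (hma j), ← lintegral_const_mul _ (hmf j),
      ← lintegral_add_left ((hma j).const_mul _)]
    simp only [p]
    rw [← lintegral_indicator_one hmeas]
    refine lintegral_mono fun ω => ?_
    by_cases h : (fun i => ξ i ω) ∈ survivalSet D z N
    swap
    · rw [indicator_of_notMem (by exact h)]; exact zero_le
    have h' : (fun i => ξ i ω) ∈ survivalSet D z j := fun i hi => h i (by omega)
    rw [indicator_of_mem (by exact h)]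
    simp only [indicator_of_mem h', Pi.one_apply]
    set y := walkPos z (fun i => ξ i ω) j
    obtain ⟨hy1, hy2⟩ : y ∈ D := h' j le_rfl
    have hy0 : 0 < y.1 := by linarith
    have hw := half_rpow_le_coneWeight (ε := ε) hy0 hy2
    have hw0 := coneWeight_nonneg (ε := ε) hy0 hy2
    simp only [K₁, K₂]
    rw [← ENNReal.ofReal_mul (by positivity), ← ENNReal.ofReal_mul (by positivity),
      ← ENNReal.ofReal_add (by positivity) (by positivity), ← ENNReal.ofReal_one]
    apply ENNReal.ofReal_le_ofReal
    rcases le_total ((N : ℝ) ^ (1 / 2 : ℝ)) y.1 with hle | hle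
    · have e1 : 1 ≤ 2 * (N : ℝ) ^ (-q) * coneWeight ε y := by
        have : (N : ℝ) ^ q ≤ y.1 ^ (1 + ε) := by
          calc (N : ℝ) ^ q = ((N : ℝ) ^ (1 / 2 : ℝ)) ^ (1 + ε) := by
                rw [← Real.rpow_mul hN0.le]; congr 1; rw [hq]; ring
            _ ≤ _ := by gcongr
        calc (1 : ℝ) = 2 * (N : ℝ) ^ (-q) * ((N : ℝ) ^ q / 2) := by
              rw [Real.rpow_neg hN0.le]
              have := (Real.rpow_pos_of_pos hN0 q).ne'
              field_simp
          _ ≤ _ := by gcongr; linarith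
      have : 0 ≤ (N : ℝ) ^ (1 - q) / c * (c * y.1 ^ (ε - 1)) := by positivity
      linarith
    · have e1 : 1 ≤ (N : ℝ) ^ (1 - q) / c * (c * y.1 ^ (ε - 1)) := by
        have : ((N : ℝ) ^ (1 / 2 : ℝ)) ^ (ε - 1) ≤ y.1 ^ (ε - 1) :=
          Real.rpow_le_rpow_of_nonpos hy0 hle (by linarith)
        rw [← Real.rpow_mul hN0.le] at this
        calc (1 : ℝ) = (N : ℝ) ^ (1 - q) * (N : ℝ) ^ (1 / 2 * (ε - 1)) := by
              rw [← Real.rpow_add hN0]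
              have : 1 - q + 1 / 2 * (ε - 1) = 0 := by rw [hq]; ring
              rw [this, Real.rpow_zero]
          _ ≤ (N : ℝ) ^ (1 - q) * y.1 ^ (ε - 1) := by gcongr
          _ = _ := by field_simp
      have : 0 ≤ 2 * (N : ℝ) ^ (-q) * coneWeight ε y := by positivity
      linarith
  have haj : ∀ j < N, a j ≤ a 0 := fun j hj => le_self_add.trans (hsum j hj.le)
  have hfs : ∑ j ∈ Finset.range N, f j ≤ a 0 := le_add_self.trans (hsum N le_rfl)
  -- Summing over all `j < N` uses the telescoped bound on the total loss; dividing by `N` gives the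
  -- decay.
  have htot : (N : ℝ≥0∞) * p ≤ (N * K₁ + K₂) * a 0 := by
    calc (N : ℝ≥0∞) * p = ∑ j ∈ Finset.range N, p := by simp
      _ ≤ ∑ j ∈ Finset.range N, (K₁ * a 0 + K₂ * f j) := by
          refine Finset.sum_le_sum fun j hj => ?_
          have hj := Finset.mem_range.1 hj
          refine (hp j hj).trans ?_
          gcongr
          exact haj j hj
      _ = N * K₁ * a 0 + K₂ * ∑ j ∈ Finset.range N, f j := by
          rw [Finset.sum_add_distrib, Finset.mul_sum]; simp [mul_assoc]
      _ ≤ N * K₁ * a 0 + K₂ * a 0 := by gcongr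
      _ = _ := by ring
  have hK : (N : ℝ≥0∞) * K₁ + K₂ = N * ENNReal.ofReal ((2 + 1 / c) * (N : ℝ) ^ (-q)) := by
    have hNe : (N : ℝ≥0∞) = ENNReal.ofReal (N : ℝ) := by simp
    simp only [K₁, K₂]
    rw [hNe, ← ENNReal.ofReal_mul hN0.le, ← ENNReal.ofReal_mul hN0.le,
      ← ENNReal.ofReal_add (by positivity) (by positivity)]
    congr 1
    have : (N : ℝ) ^ (1 - q) = N * (N : ℝ) ^ (-q) := by
      rw [sub_eq_add_neg, Real.rpow_add hN0, Real.rpow_one]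
    rw [this]
    field_simp
  rw [hK, mul_assoc] at htot
  have hNne : (N : ℝ≥0∞) ≠ 0 := by
    simp only [ne_eq, Nat.cast_eq_zero]; omega
  have := (ENNReal.mul_le_mul_iff_right hNne (ENNReal.natCast_ne_top N)).1 htot
  exact this.trans (by gcongr)

end

/-! ### Independent blocks of steps, and small-box estimates -/

section

variable {Ω : Type*} [MeasurableSpace Ω] {P : Measure Ω}

/-- The sequence `x` with the entries outside `S` replaced by `0`. -/
def maskedSeq {E : Type*} [Zero E] (S : Finset ℕ) (x : ℕ → E) : ℕ → E :=
  fun i => if i ∈ S then x i else 0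

lemma maskedSeq_apply {E : Type*} [Zero E] {S : Finset ℕ} {x : ℕ → E} {i : ℕ} (hi : i ∈ S) :
    maskedSeq S x i = x i := if_pos hi

/-- Keeping blocks as full sequences padded by zeros lets one event on sequences be evaluated on any
block. -/
lemma indepFun_maskedSeq {ζ : ℕ → Ω → ℝ × ℝ} (hζ : ∀ i, AEMeasurable (ζ i) P)
    (hind : iIndepFun ζ P) {S T : Finset ℕ} (hST : Disjoint S T) :
    IndepFun (fun ω => maskedSeq S (fun i => ζ i ω)) (fun ω => maskedSeq T (fun i => ζ i ω)) P := by
  have hmeas : ∀ U : Finset ℕ, Measurable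
      (fun (y : U → ℝ × ℝ) (i : ℕ) => if h : i ∈ U then y ⟨i, h⟩ else 0) := fun U => by
    refine measurable_pi_lambda _ fun i => ?_
    by_cases h : i ∈ U
    · simpa [h] using measurable_pi_apply _
    · simp [h]
  have := (hind.indepFun_finset₀ S T hST hζ).comp (hmeas S) (hmeas T)
  refine this.congr (Filter.Eventually.of_forall fun ω => ?_)
    (Filter.Eventually.of_forall fun ω => ?_) <;>
  · ext i : 1
    simp only [Function.comp_apply, maskedSeq]
    split_ifs <;> rfl

lemma aemeasurable_maskedSeq {ζ : ℕ → Ω → ℝ × ℝ} (hζ : ∀ i, AEMeasurable (ζ i) P)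
    (S : Finset ℕ) : AEMeasurable (fun ω => maskedSeq S (fun i => ζ i ω)) P := by
  refine aemeasurable_pi_lambda _ fun i => ?_
  by_cases h : i ∈ S
  · simpa [maskedSeq, h] using hζ i
  · simp [maskedSeq, h]

/-- The steps of a reindexed and transformed sub-family are independent of their past. -/
lemma indepFun_past_of_iIndepFun {ζ : ℕ → Ω → ℝ × ℝ} (hζ : ∀ i, AEMeasurable (ζ i) P)
    (hind : iIndepFun ζ P) {e : ℕ → ℕ} {n : ℕ} (he : ∀ i < n, e i ≠ e n)
    {g : ℝ × ℝ → ℝ × ℝ} (hg : Measurable g) :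
    IndepFun (fun ω (i : Fin n) => g (ζ (e i) ω)) (fun ω => g (ζ (e n) ω)) P := by
  have hd : Disjoint ((Finset.range n).image e) {e n} := by
    rw [Finset.disjoint_singleton_right, Finset.mem_image]
    rintro ⟨i, hi, h⟩
    exact he i (Finset.mem_range.1 hi) h
  have h1 : Measurable (fun (x : ℕ → ℝ × ℝ) (i : Fin n) => g (x (e i))) := by fun_prop
  have h2 : Measurable (fun (x : ℕ → ℝ × ℝ) => g (x (e n))) := by fun_prop
  refine ((indepFun_maskedSeq hζ hind hd).comp h1 h2).congr
    (Filter.Eventually.of_forall fun ω => ?_) (Filter.Eventually.of_forall fun ω => ?_)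
  · ext i : 1
    simp only [Function.comp_apply]
    rw [maskedSeq_apply (Finset.mem_image_of_mem e (Finset.mem_range.2 i.2))]
  · simp only [Function.comp_apply]
    rw [maskedSeq_apply (Finset.mem_singleton_self _)]

/-- The step sequences for which the walk started at the origin stays in the cone with apex
`(-h, 0)` up to time `N`. -/
def coneSurvival (h : ℝ) (N : ℕ) : Set (ℕ → ℝ × ℝ) :=
  {x | ∀ j ≤ N, |(∑ i ∈ Finset.range j, x i).2| ≤ (∑ i ∈ Finset.range j, x i).1 + h}

lemma measurableSet_coneSurvival (h : ℝ) (N : ℕ) : MeasurableSet (coneSurvival h N) := by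
  simp only [coneSurvival, ofPred_forall]
  refine MeasurableSet.iInter fun j => MeasurableSet.iInter fun _ => ?_
  exact measurableSet_le (by fun_prop) (by fun_prop)

lemma coneSurvival_congr {h : ℝ} {N : ℕ} {x y : ℕ → ℝ × ℝ} (hxy : ∀ i < N, x i = y i) :
    x ∈ coneSurvival h N ↔ y ∈ coneSurvival h N := by
  simp only [coneSurvival, mem_ofPred_eq]
  refine forall₂_congr fun j hj => ?_
  rw [Finset.sum_congr rfl fun i hi => hxy i ((Finset.mem_range.1 hi).trans_le hj)]

/-- The survival bound for the walk, with constants depending only on the step law. -/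
lemma exists_measure_coneSurvival_le {a b : ℝ≥0} (hb : 0 < b) {ε : ℝ} (hε0 : 0 < ε) (hε1 : ε ≤ 1)
    (hε : ε * a ≤ b / 4) :
    ∃ H₀ C : ℝ, 1 ≤ H₀ ∧ 0 < C ∧ ∀ (Ω : Type*) [MeasurableSpace Ω] (P : Measure Ω)
      [IsProbabilityMeasure P] (ξ : ℕ → Ω → ℝ × ℝ) (N : ℕ) (h : ℝ), H₀ ≤ h → 1 ≤ N →
      (∀ n < N, HasLaw (ξ n) (stepLaw a b) P) →
      (∀ n < N, IndepFun (fun ω (i : Fin n) => ξ i ω) (ξ n) P) →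
      P {ω | (fun i => ξ i ω) ∈ coneSurvival h N} ≤
        ENNReal.ofReal (C * h ^ (1 + ε) * (N : ℝ) ^ (-((1 + ε) / 2))) := by
  obtain ⟨H₀, c, hH₀, hc, hdrift⟩ := exists_coneWeight_drift hb hε0 hε1 hε
  refine ⟨H₀, (2 + 1 / c) * 2 ^ (1 + ε), hH₀, by positivity, ?_⟩
  intro Ω _ P _ ξ N h hh hN hlaw hind
  have h0 : 0 < h := by linarith
  -- Measurable versions of the first `N` steps, with zero steps afterwards.
  let ξ' : ℕ → Ω → ℝ × ℝ := fun n =>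
    if hn : n < N then (hlaw n hn).aemeasurable.mk (ξ n) else fun _ => 0
  have hξ' : ∀ n, Measurable (ξ' n) := fun n => by
    by_cases hn : n < N
    · simpa [ξ', hn] using (hlaw n hn).aemeasurable.measurable_mk
    · simp [ξ', hn]
  have hae : ∀ n < N, ξ n =ᵐ[P] ξ' n := fun n hn => by
    simpa [ξ', hn] using (hlaw n hn).aemeasurable.ae_eq_mk
  have hall : ∀ᵐ ω ∂P, ∀ n, n < N → ξ n ω = ξ' n ω := by
    rw [ae_all_iff]
    intro n
    by_cases hn : n < N
    · filter_upwards [hae n hn] with ω hω _ using hω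
    · exact Filter.Eventually.of_forall fun ω h => absurd h hn
  -- Starting at `(2h, 0)`, a walk in the cone with apex `(h, 0)` has first coordinate at least `h`
  -- and at least `|v|`, so it lies in `truncatedCone h`.
  have key := measure_survivalSet_le (P := P) (ν := stepLaw a b) (ξ := ξ') hε0 hε1 hc
    (hH₀.trans hh) (hdrift h hh) hξ' hN
    (fun n hn => (hind n hn).congr (by
      filter_upwards [hall] with ω hω
      ext i : 1
      exact hω i (i.2.trans hn)) (hae n hn))
    (fun n hn => by rw [← Measure.map_congr (hae n hn), (hlaw n hn).map_eq])
    (z := (2 * h, 0))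
  have hcw : coneWeight ε (2 * h, 0) = 2 ^ (1 + ε) * h ^ (1 + ε) := by
    simp [coneWeight, Real.mul_rpow (by norm_num : (0 : ℝ) ≤ 2) h0.le]
  rw [hcw, ← ENNReal.ofReal_mul (by positivity)] at key
  refine le_trans ?_ (key.trans (ENNReal.ofReal_le_ofReal (le_of_eq (by ring))))
  refine measure_mono_ae ?_
  filter_upwards [hall] with ω hω hmem
  have hmem' := (coneSurvival_congr (fun i hi => hω i hi)).1 hmem
  intro i hi
  have := hmem' i hi
  simp only [walkPos, truncatedCone, mem_ofPred_eq, Prod.fst_add, Prod.snd_add, zero_add]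
  constructor <;> linarith [abs_nonneg (∑ k ∈ Finset.range i, ξ' k ω).2]

lemma gaussianReal_Icc_le {v : ℝ≥0} (hv : 0 < v) (c d : ℝ) :
    gaussianReal 0 v (Icc c d) ≤ ENNReal.ofReal ((√v)⁻¹ * (d - c)) := by
  have hv' : (0 : ℝ) < v := by exact_mod_cast hv
  rw [gaussianReal_apply _ hv.ne']
  calc ∫⁻ x in Icc c d, gaussianPDF 0 v x ≤ ∫⁻ _ in Icc c d, ENNReal.ofReal (√v)⁻¹ := by
        refine lintegral_mono fun x => ?_
        refine ENNReal.ofReal_le_ofReal ?_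
        rw [gaussianPDFReal]
        have h1 : Real.exp (-(x - 0) ^ 2 / (2 * v)) ≤ 1 := by
          rw [Real.exp_le_one_iff]
          exact div_nonpos_of_nonpos_of_nonneg (by nlinarith [sq_nonneg (x - 0)]) (by positivity)
        have h2 : (√(2 * Real.pi * v))⁻¹ ≤ (√v)⁻¹ := by
          gcongr
          nlinarith [Real.pi_gt_three]
        calc _ ≤ (√(2 * Real.pi * v))⁻¹ * 1 := by gcongr
          _ ≤ _ := by simpa using h2
    _ = _ := by
        rw [lintegral_const, Measure.restrict_apply_univ, Real.volume_Icc,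
          ENNReal.ofReal_mul (by positivity)]

lemma stepLaw_box_le {a b : ℝ≥0} (ha : 0 < a) (hb : 0 < b) {l : ℝ} (hl : 0 < l) {h : ℝ}
    (hh : 0 ≤ h) (s : ℝ × ℝ) :
    stepLaw (a * l.toNNReal) (b * l.toNNReal) {x | |s.1 + x.1| ≤ h ∧ |s.2 + x.2| ≤ h} ≤
      ENNReal.ofReal (4 * (√(a * b))⁻¹ * h ^ 2 / l) := by
  have hl' : 0 < l.toNNReal := Real.toNNReal_pos.2 hl
  have hset : {x : ℝ × ℝ | |s.1 + x.1| ≤ h ∧ |s.2 + x.2| ≤ h} =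
      Icc (-h - s.1) (h - s.1) ×ˢ Icc (-h - s.2) (h - s.2) := by
    ext x
    simp only [mem_ofPred_eq, mem_prod, mem_Icc, abs_le]
    constructor
    · rintro ⟨⟨h1, h2⟩, h3, h4⟩
      refine ⟨⟨?_, ?_⟩, ?_, ?_⟩ <;> linarith
    · rintro ⟨⟨h1, h2⟩, h3, h4⟩
      refine ⟨⟨?_, ?_⟩, ?_, ?_⟩ <;> linarith
  rw [hset, stepLaw, Measure.prod_prod]
  refine (mul_le_mul' (gaussianReal_Icc_le (mul_pos ha hl') _ _)
    (gaussianReal_Icc_le (mul_pos hb hl') _ _)).trans ?_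
  rw [← ENNReal.ofReal_mul (mul_nonneg (by positivity) (by linarith))]
  refine ENNReal.ofReal_le_ofReal (le_of_eq ?_)
  have e : ((l.toNNReal : ℝ≥0) : ℝ) = l := Real.coe_toNNReal _ hl.le
  have e1 : √(((a * l.toNNReal : ℝ≥0) : ℝ)) * √(((b * l.toNNReal : ℝ≥0) : ℝ)) = √(a * b) * l := by
    rw [← Real.sqrt_mul (by positivity)]
    push_cast
    rw [e, show (a : ℝ) * l * (b * l) = a * b * l ^ 2 by ring, Real.sqrt_mul (by positivity),
      Real.sqrt_sq hl.le]
  calc _ = (√(((a * l.toNNReal : ℝ≥0) : ℝ)) * √(((b * l.toNNReal : ℝ≥0) : ℝ)))⁻¹ * (4 * h ^ 2) := by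
        rw [mul_inv]; ring
    _ = _ := by rw [e1, mul_inv]; ring

/-- Fubini: conditionally on `Y`, the second constraint costs at most `κ`. It is used with `Y` the
two end blocks and `M` the middle increment. -/
lemma measure_inter_le_of_indepFun [IsProbabilityMeasure P] {S E : Type*} [MeasurableSpace S] [MeasurableSpace E]
    {Y : Ω → S} {M : Ω → E} (hY : AEMeasurable Y P) (hM : AEMeasurable M P) (hind : IndepFun Y M P)
    {A : Set S} (hA : MeasurableSet A) {G : Set (S × E)} (hG : MeasurableSet G) {κ : ℝ≥0∞}
    (hκ : ∀ y, P.map M (Prod.mk y ⁻¹' G) ≤ κ) :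
    P {ω | Y ω ∈ A ∧ (Y ω, M ω) ∈ G} ≤ κ * P {ω | Y ω ∈ A} := by
  have hmap := (indepFun_iff_map_prod_eq_prod_map_map hY hM).1 hind
  have : IsProbabilityMeasure (P.map M) := Measure.isProbabilityMeasure_map hM
  have hGA : MeasurableSet ((A ×ˢ univ) ∩ G) := (hA.prod MeasurableSet.univ).inter hG
  have e1 : P {ω | Y ω ∈ A ∧ (Y ω, M ω) ∈ G} =
      P.map (fun ω => (Y ω, M ω)) ((A ×ˢ univ) ∩ G) := by
    rw [Measure.map_apply_of_aemeasurable (hY.prodMk hM) hGA]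
    congr 1; ext ω; simp
  have e2 : P {ω | Y ω ∈ A} = P.map Y A := by
    rw [Measure.map_apply_of_aemeasurable hY hA]; rfl
  rw [e1, e2, hmap, Measure.prod_apply hGA, ← lintegral_indicator_const hA]
  refine lintegral_mono fun y => ?_
  by_cases hy : y ∈ A
  · rw [indicator_of_mem hy]
    refine (measure_mono ?_).trans (hκ y)
    intro x hx; exact hx.2
  · rw [indicator_of_notMem hy]
    have : Prod.mk y ⁻¹' ((A ×ˢ univ) ∩ G) = ∅ := by ext; simp [hy]
    rw [this]; simp

end

/-! ### Approximate cone bridges -/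

/-- A planar process, indexed by the real line, with continuous paths and independent increments,
whose two coordinates are uncorrelated Brownian motions with variances `a` and `b`. -/
structure IsDiagonalBrownian {Ω : Type*} [MeasurableSpace Ω] (a b : ℝ≥0)
    (W : ℝ → Ω → ℝ × ℝ) (P : Measure Ω) : Prop where
  indepIncrements : HasIndepIncrements W P
  hasLaw_sub : ∀ s t : ℝ, s ≤ t →
    HasLaw (fun ω => W t ω - W s ω) (stepLaw (a * (t - s).toNNReal) (b * (t - s).toNNReal)) P
  continuous_paths : ∀ᵐ ω ∂P, Continuous (fun t => W t ω)

lemma stepLaw_map_neg (a b : ℝ≥0) : (stepLaw a b).map (fun x => -x) = stepLaw a b := by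
  have : (fun x : ℝ × ℝ => -x) = Prod.map (fun x => -x) (fun x => -x) := by ext x <;> rfl
  rw [this, stepLaw, ← Measure.map_prod_map _ _ measurable_neg measurable_neg, gaussianReal_map_neg,
    gaussianReal_map_neg]
  simp

/-- The event that the path stays close to a cone with apex at time `s` for the next `L` integer
steps, close to a cone with apex at time `t` for the `L` integer steps before `t`, and that its
values at `s` and `t` are close. -/
def coneBridge (s t h : ℝ) (L : ℕ) : Set (ℝ → ℝ × ℝ) :=
  {w | (∀ j : ℕ, j ≤ L → |(w (s + j) - w s).2| ≤ (w (s + j) - w s).1 + h) ∧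
    (∀ j : ℕ, j ≤ L → |(w (t - j) - w t).2| ≤ (w (t - j) - w t).1 + h) ∧
    |(w t - w s).1| ≤ h ∧ |(w t - w s).2| ≤ h}

/-- The subdivision of `[s, t]` with unit steps on `[s, s + L]` and `[t - L, t]`. -/
noncomputable def bridgeTimes (s t : ℝ) (L i : ℕ) : ℝ :=
  if i ≤ L then s + i else t + i - 2 * L - 1

lemma monotone_bridgeTimes {s t : ℝ} {L : ℕ} (h : s + 2 * L ≤ t) : Monotone (bridgeTimes s t L) := by
  refine monotone_nat_of_le_succ fun i => ?_
  simp only [bridgeTimes]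
  push_cast
  split_ifs with h1 h2 h2
  · linarith
  · have : i = L := by omega
    subst this
    linarith
  · omega
  · linarith

/-- The two end blocks and the middle increment are independent. Each end contributes a survival
factor; given the ends, the middle increment must hit a box of side `2h`, whose probability is `O(h
^ 2 / (t - s - 2 * L))`. -/
lemma exists_measure_coneBridge_le {a b : ℝ≥0} (ha : 0 < a) (hb : 0 < b) {ε : ℝ} (hε0 : 0 < ε)
    (hε1 : ε ≤ 1) (hε : ε * a ≤ b / 4) :
    ∃ H₀ C : ℝ, 1 ≤ H₀ ∧ 0 < C ∧ ∀ (Ω : Type*) [MeasurableSpace Ω] (P : Measure Ω)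
      [IsProbabilityMeasure P] (W : ℝ → Ω → ℝ × ℝ), IsDiagonalBrownian a b W P →
      ∀ (s t h : ℝ) (L : ℕ), H₀ ≤ h → 1 ≤ L → s + 2 * L < t →
        P {ω | (fun r => W r ω) ∈ coneBridge s t h L} ≤
          ENNReal.ofReal (C * (h ^ (1 + ε) * (L : ℝ) ^ (-((1 + ε) / 2))) ^ 2 *
            (h ^ 2 / (t - s - 2 * L))) := by
  obtain ⟨H₀, C, hH₀, hC, hsurv⟩ := exists_measure_coneSurvival_le hb hε0 hε1 hε
  have ha' : (0 : ℝ) < a := by exact_mod_cast ha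
  have hb' : (0 : ℝ) < b := by exact_mod_cast hb
  refine ⟨H₀, C ^ 2 * (4 * (√(a * b))⁻¹), hH₀, by positivity, ?_⟩
  intro Ω _ P _ W hW s t h L hh hL hst
  have h0 : 0 < h := by linarith
  set τ := bridgeTimes s t L
  have hτ : Monotone τ := monotone_bridgeTimes hst.le
  let ζ : ℕ → Ω → ℝ × ℝ := fun i ω => W (τ (i + 1)) ω - W (τ i) ω
  have hζlaw : ∀ i, HasLaw (ζ i) (stepLaw (a * (τ (i + 1) - τ i).toNNReal)
      (b * (τ (i + 1) - τ i).toNNReal)) P := fun i => hW.hasLaw_sub _ _ (hτ (Nat.le_succ i))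
  have hζ : ∀ i, AEMeasurable (ζ i) P := fun i => (hζlaw i).aemeasurable
  have hind : iIndepFun ζ P := hW.indepIncrements.nat hτ
  -- Step `L` is the long one, from `s + L` to `t - L`; index `2 * L + 1` is time `t`.
  have hτ1 : ∀ i ≤ L, τ i = s + i := fun i hi => if_pos hi
  have hτ2 : ∀ i, L < i → τ i = t + i - 2 * L - 1 := fun i hi => if_neg (not_le.2 hi)
  have hunit : ∀ i, i ≠ L → τ (i + 1) - τ i = 1 := by
    intro i hi
    rcases lt_or_gt_of_ne hi with h | h
    · rw [hτ1 _ (by omega), hτ1 _ (by omega)]; push_cast; ring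
    · rw [hτ2 _ (by omega), hτ2 _ (by omega)]; push_cast; ring
  have hlaw1 : ∀ i, i ≠ L → HasLaw (ζ i) (stepLaw a b) P := fun i hi => by
    simpa [hunit i hi] using hζlaw i
  have hmid : HasLaw (ζ L) (stepLaw (a * (t - s - 2 * L).toNNReal)
      (b * (t - s - 2 * L).toNNReal)) P := by
    have : τ (L + 1) - τ L = t - s - 2 * L := by
      rw [hτ2 _ (by omega), hτ1 _ le_rfl]; push_cast; ring
    simpa [this] using hζlaw L
  set S₁ := Finset.range L
  set S₂ := Finset.Ioc L (2 * L)
  -- Steps read backwards from `t`: reversed order, opposite sign. The step law is symmetric, so the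
  -- same survival bound applies.
  set back : (ℕ → ℝ × ℝ) → ℕ → ℝ × ℝ := fun x i => -x (2 * L - i)
  have hbackm : Measurable back := by
    refine measurable_pi_lambda _ fun i => ?_
    exact (measurable_pi_apply _).neg
  set F₁ := coneSurvival h L
  set F₂ := back ⁻¹' coneSurvival h L
  have hF₁ : MeasurableSet F₁ := measurableSet_coneSurvival h L
  have hF₂ : MeasurableSet F₂ := hbackm (measurableSet_coneSurvival h L)
  have hF₁c : ∀ x y : ℕ → ℝ × ℝ, (∀ i ∈ S₁, x i = y i) → (x ∈ F₁ ↔ y ∈ F₁) := fun x y hxy =>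
    coneSurvival_congr fun i hi => hxy i (Finset.mem_range.2 hi)
  have hF₂c : ∀ x y : ℕ → ℝ × ℝ, (∀ i ∈ S₂, x i = y i) → (x ∈ F₂ ↔ y ∈ F₂) := fun x y hxy =>
    coneSurvival_congr fun i hi => by
      simp only [back]
      rw [hxy]
      simp only [S₂, Finset.mem_Ioc]; omega
  have hP₁ : P {ω | (fun i => ζ i ω) ∈ F₁} ≤
      ENNReal.ofReal (C * h ^ (1 + ε) * (L : ℝ) ^ (-((1 + ε) / 2))) := by
    refine hsurv Ω P ζ L h hh hL (fun n hn => hlaw1 n hn.ne) fun n hn => ?_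
    exact indepFun_past_of_iIndepFun (e := id) (g := id) hζ hind (fun i hi => hi.ne) measurable_id
  have hP₂ : P {ω | (fun i => ζ i ω) ∈ F₂} ≤
      ENNReal.ofReal (C * h ^ (1 + ε) * (L : ℝ) ^ (-((1 + ε) / 2))) := by
    refine hsurv Ω P (fun i ω => -ζ (2 * L - i) ω) L h hh hL (fun n hn => ?_) fun n hn => ?_
    · have hl := hlaw1 (2 * L - n) (by omega)
      refine ⟨hl.aemeasurable.neg, ?_⟩
      have : P.map (fun ω => -ζ (2 * L - n) ω) =
          (P.map (ζ (2 * L - n))).map (fun x => -x) := by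
        rw [AEMeasurable.map_map_of_aemeasurable measurable_neg.aemeasurable hl.aemeasurable]; rfl
      rw [this, hl.map_eq, stepLaw_map_neg]
    · exact indepFun_past_of_iIndepFun (e := fun i => 2 * L - i) (g := fun x => -x) hζ hind
        (fun i hi => by omega) measurable_neg
  have hm₁₂ := aemeasurable_maskedSeq hζ (S₁ ∪ S₂)
  have hd₁₂ : Disjoint S₁ S₂ := by
    rw [Finset.disjoint_left]
    intro i h1 h2
    simp only [S₁, S₂, Finset.mem_range, Finset.mem_Ioc] at h1 h2
    omega
  have hdL : Disjoint (S₁ ∪ S₂) {L} := by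
    rw [Finset.disjoint_singleton_right]
    simp [S₁, S₂]
  have hi₁₂ := indepFun_maskedSeq hζ hind hd₁₂
  have hiL : IndepFun (fun ω => maskedSeq (S₁ ∪ S₂) (fun i => ζ i ω)) (ζ L) P := by
    refine ((indepFun_maskedSeq hζ hind hdL).comp measurable_id (measurable_pi_apply L)).congr
      (Filter.EventuallyEq.rfl) (Filter.Eventually.of_forall fun ω => ?_)
    simp [maskedSeq]
  have hP₁₂ : P {ω | maskedSeq (S₁ ∪ S₂) (fun i => ζ i ω) ∈ F₁ ∩ F₂} ≤
      ENNReal.ofReal (C * h ^ (1 + ε) * (L : ℝ) ^ (-((1 + ε) / 2))) ^ 2 := by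
    have e : {ω | maskedSeq (S₁ ∪ S₂) (fun i => ζ i ω) ∈ F₁ ∩ F₂} =
        (fun ω => maskedSeq S₁ (fun i => ζ i ω)) ⁻¹' F₁ ∩
        (fun ω => maskedSeq S₂ (fun i => ζ i ω)) ⁻¹' F₂ := by
      ext ω
      simp only [mem_ofPred_eq, mem_inter_iff, mem_preimage]
      rw [hF₁c _ (maskedSeq S₁ (fun i => ζ i ω)), hF₂c _ (maskedSeq S₂ (fun i => ζ i ω))]
      · intro i hi
        rw [maskedSeq_apply hi, maskedSeq_apply (Finset.mem_union_right _ hi)]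
      · intro i hi
        rw [maskedSeq_apply hi, maskedSeq_apply (Finset.mem_union_left _ hi)]
    rw [e, hi₁₂.measure_inter_preimage_eq_mul _ _ hF₁ hF₂, sq]
    refine mul_le_mul' (le_of_eq_of_le ?_ hP₁) (le_of_eq_of_le ?_ hP₂)
    · congr 1; ext ω
      exact hF₁c _ _ fun i hi => maskedSeq_apply hi
    · congr 1; ext ω
      exact hF₂c _ _ fun i hi => maskedSeq_apply hi
  let tot : (ℕ → ℝ × ℝ) → ℝ × ℝ := fun x => ∑ i ∈ S₁ ∪ S₂, x i
  have htot : Measurable tot := by simp only [tot]; fun_prop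
  let G : Set ((ℕ → ℝ × ℝ) × (ℝ × ℝ)) :=
    {p | |(tot p.1).1 + p.2.1| ≤ h ∧ |(tot p.1).2 + p.2.2| ≤ h}
  have hG : MeasurableSet G := by
    refine MeasurableSet.inter (s₁ := {p : (ℕ → ℝ × ℝ) × (ℝ × ℝ) | |(tot p.1).1 + p.2.1| ≤ h})
      (s₂ := {p : (ℕ → ℝ × ℝ) × (ℝ × ℝ) | |(tot p.1).2 + p.2.2| ≤ h})
      (measurableSet_le ?_ measurable_const) (measurableSet_le ?_ measurable_const)
    · exact (((measurable_fst.comp (htot.comp measurable_fst)).add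
        (measurable_fst.comp measurable_snd))).abs
    · exact (((measurable_snd.comp (htot.comp measurable_fst)).add
        (measurable_snd.comp measurable_snd))).abs
  have hfinal := measure_inter_le_of_indepFun hm₁₂ (hζ L) hiL (hF₁.inter hF₂) hG
    (κ := ENNReal.ofReal (4 * (√(a * b))⁻¹ * h ^ 2 / (t - s - 2 * L))) (fun y => by
      rw [hmid.map_eq]
      exact stepLaw_box_le ha hb (by linarith) h0.le (tot y))
  have hsub : {ω | (fun r => W r ω) ∈ coneBridge s t h L} ⊆
      {ω | maskedSeq (S₁ ∪ S₂) (fun i => ζ i ω) ∈ F₁ ∩ F₂ ∧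
        (maskedSeq (S₁ ∪ S₂) (fun i => ζ i ω), ζ L ω) ∈ G} := by
    rintro ω ⟨hw1, hw2, hw3, hw4⟩
    refine ⟨⟨?_, ?_⟩, ?_⟩
    · rw [hF₁c _ (fun i => ζ i ω) fun i hi => maskedSeq_apply (Finset.mem_union_left _ hi)]
      intro j hj
      have : ∑ i ∈ Finset.range j, ζ i ω = W (s + j) ω - W s ω := by
        rw [Finset.sum_range_sub (fun i => W (τ i) ω), hτ1 j hj, hτ1 0 (Nat.zero_le _)]
        simp
      rw [this]
      exact hw1 j hj
    · rw [hF₂c _ (fun i => ζ i ω) fun i hi => maskedSeq_apply (Finset.mem_union_right _ hi)]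
      intro j hj
      have : ∑ i ∈ Finset.range j, back (fun i => ζ i ω) i = W (t - j) ω - W t ω := by
        have e1 : ∑ i ∈ Finset.range j, back (fun i => ζ i ω) i =
            ∑ i ∈ Finset.range j, (W (t - ((i + 1 : ℕ) : ℝ)) ω - W (t - (i : ℝ)) ω) := by
          refine Finset.sum_congr rfl fun i hi => ?_
          have hi := Finset.mem_range.1 hi
          simp only [back, ζ]
          rw [hτ2 _ (by omega), hτ2 _ (by omega), neg_sub]
          have hc : ((2 * L - i : ℕ) : ℝ) = 2 * L - i := by
            rw [Nat.cast_sub (by omega)]; push_cast; ring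
          push_cast
          rw [hc]
          congr 2 <;> ring_nf
        rw [e1, Finset.sum_range_sub (fun i : ℕ => W (t - (i : ℝ)) ω)]
        simp
      rw [this]
      exact hw2 j hj
    · have : tot (maskedSeq (S₁ ∪ S₂) (fun i => ζ i ω)) + ζ L ω = W t ω - W s ω := by
        have e1 : tot (maskedSeq (S₁ ∪ S₂) (fun i => ζ i ω)) = ∑ i ∈ S₁ ∪ S₂, ζ i ω :=
          Finset.sum_congr rfl fun i hi => maskedSeq_apply hi
        have e2 : Finset.range (2 * L + 1) = (S₁ ∪ S₂) ∪ {L} := by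
          ext i
          simp only [S₁, S₂, Finset.mem_range, Finset.mem_union, Finset.mem_Ioc,
            Finset.mem_singleton]
          omega
        have e3 := Finset.sum_range_sub (fun i => W (τ i) ω) (2 * L + 1)
        rw [e2, Finset.sum_union hdL, Finset.sum_singleton, hτ2 (2 * L + 1) (by omega),
          hτ1 0 (Nat.zero_le _)] at e3
        rw [e1]
        simp only [ζ]
        rw [e3]
        push_cast
        congr 2 <;> ring_nf
      have h1 := congrArg Prod.fst this
      have h2 := congrArg Prod.snd this
      simp only [Prod.fst_add, Prod.snd_add] at h1 h2
      simp only [G, mem_ofPred_eq, h1, h2]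
      exact ⟨hw3, hw4⟩
  refine (measure_mono hsub).trans (hfinal.trans ((mul_le_mul_right hP₁₂ _).trans (le_of_eq ?_)))
  rw [← ENNReal.ofReal_pow (by positivity), ← ENNReal.ofReal_mul
    (div_nonneg (by positivity) (by linarith))]
  congr 1
  ring

/-! ### Oscillation over unit intervals -/

/-- Dyadic chaining. -/
lemma abs_sub_le_sum_of_dyadic_increments {x : ℝ → ℝ} {δ : ℕ → ℝ} (hδ : ∀ n, 0 ≤ δ n)
    (h : ∀ n j : ℕ, j < 2 ^ n → |x ((j + 1 : ℕ) / 2 ^ n) - x (j / 2 ^ n)| ≤ δ n) (n : ℕ) :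
    ∀ j : ℕ, j ≤ 2 ^ n → |x (j / 2 ^ n) - x 0| ≤ ∑ i ∈ Finset.range (n + 1), δ i := by
  induction n with
  | zero =>
    intro j hj
    have : j = 0 ∨ j = 1 := by simp at hj; omega
    rcases this with rfl | rfl
    · simpa using hδ 0
    · simpa using h 0 0 (by norm_num)
  | succ n ih =>
    intro j hj
    rw [Finset.sum_range_succ]
    have hhalf : ∀ i : ℕ, ((2 * i : ℕ) : ℝ) / 2 ^ (n + 1) = i / 2 ^ n := fun i => by
      push_cast; rw [pow_succ]; field_simp
    rw [pow_succ] at hj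
    rcases Nat.even_or_odd' j with ⟨i, rfl | rfl⟩
    · rw [hhalf]
      linarith [ih i (by omega), hδ (n + 1)]
    · have h1 := h (n + 1) (2 * i) (by rw [pow_succ]; omega)
      rw [hhalf] at h1
      have h2 := ih i (by omega)
      calc _ ≤ _ := abs_sub_le _ (x (i / 2 ^ n)) _
        _ ≤ _ := by linarith

lemma dyadic_dense_Icc {x : ℝ → ℝ} (hx : Continuous x) {K : ℝ}
    (h : ∀ n j : ℕ, j ≤ 2 ^ n → |x (j / 2 ^ n) - x 0| ≤ K) {r : ℝ} (hr : r ∈ Icc (0 : ℝ) 1) :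
    |x r - x 0| ≤ K := by
  have hlim : Filter.Tendsto (fun n : ℕ => (⌊r * 2 ^ n⌋₊ : ℝ) / 2 ^ n) Filter.atTop (nhds r) := by
    have := (tendsto_nat_floor_mul_div_atTop (R := ℝ) hr.1).comp
      (tendsto_pow_atTop_atTop_of_one_lt (r := (2 : ℝ)) (by norm_num))
    exact this
  have hc : Filter.Tendsto (fun n : ℕ => |x ((⌊r * 2 ^ n⌋₊ : ℝ) / 2 ^ n) - x 0|) Filter.atTop
      (nhds |x r - x 0|) := (((hx.tendsto r).comp hlim).sub_const _).abs
  refine le_of_tendsto hc (Filter.Eventually.of_forall fun n => h n _ ?_)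
  rw [← Nat.cast_le (α := ℝ)]
  refine (Nat.floor_le (by have := hr.1; positivity)).trans ?_
  push_cast
  exact mul_le_of_le_one_left (by positivity) hr.2

/-- Polynomial tail bound for a centred Gaussian variable. -/
lemma exists_gaussianReal_abs_gt_le (a : ℝ≥0) (p : ℕ) :
    ∃ M : ℝ, 0 ≤ M ∧ ∀ (l : ℝ≥0) (δ : ℝ), 0 < δ →
      gaussianReal 0 (a * l ^ 2) {x | δ < |x|} ≤ ENNReal.ofReal (M * (l / δ) ^ p) := by
  refine ⟨∫ x, |x| ^ p ∂(gaussianReal 0 a), integral_nonneg fun x => by positivity, ?_⟩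
  intro l δ hδ
  have hmap : gaussianReal 0 (a * l ^ 2) = (gaussianReal 0 a).map (fun x => (l : ℝ) * x) := by
    rw [gaussianReal_map_const_mul]
    congr 1
    · simp
    · ext; push_cast; ring
  have hms : MeasurableSet {x : ℝ | δ < |x|} := measurableSet_lt measurable_const (by fun_prop)
  rw [hmap, Measure.map_apply (by fun_prop) hms]
  have hint : Integrable (fun x : ℝ => |x| ^ p) (gaussianReal 0 a) := by
    simpa [abs_pow] using (integrable_pow_gaussianReal a p).abs
  rw [← integral_mul_const, ofReal_integral_eq_lintegral_ofReal (hint.mul_const _)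
    (Filter.Eventually.of_forall fun x => by positivity)]
  rw [← lintegral_indicator_one (by exact (by fun_prop : Measurable fun x : ℝ => (l : ℝ) * x) hms)]
  refine lintegral_mono fun x => ?_
  by_cases hx : x ∈ (fun x => (l : ℝ) * x) ⁻¹' {x | δ < |x|}
  · rw [indicator_of_mem hx]
    simp only [Pi.one_apply]
    rw [← ENNReal.ofReal_one]
    refine ENNReal.ofReal_le_ofReal ?_
    rw [← mul_pow]
    apply one_le_pow₀
    simp only [mem_preimage, mem_ofPred_eq, abs_mul, NNReal.abs_eq] at hx
    rw [← mul_div_assoc, le_div_iff₀ hδ]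
    linarith
  · rw [indicator_of_notMem hx]; exact zero_le

/-- Tail bound for the oscillation of a Brownian path over a unit interval. -/
lemma exists_measure_oscillation_le (a : ℝ≥0) (p : ℕ) (hp : 8 ≤ p) :
    ∃ M : ℝ, 0 ≤ M ∧ ∀ (Ω : Type*) [MeasurableSpace Ω] (P : Measure Ω) (B : ℝ → Ω → ℝ),
      (∀ s t : ℝ, s ≤ t → HasLaw (fun ω => B t ω - B s ω) (gaussianReal 0 (a * (t - s).toNNReal)) P) →
      (∀ᵐ ω ∂P, Continuous fun t => B t ω) → ∀ s h : ℝ, 0 < h →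
      P {ω | ∃ r ∈ Icc s (s + 1), h < |B r ω - B s ω|} ≤ ENNReal.ofReal (M * h⁻¹ ^ p) := by
  obtain ⟨M, hM, hG⟩ := exists_gaussianReal_abs_gt_le a p
  -- `ρ = 2 ^ (-1/4)`. Level-`n` dyadic increments have standard deviation proportional to `ρ ^ (2 *
  -- n)`, against the threshold `κ * h * ρ ^ n`. Moments of order `p ≥ 8` give `4 ^ (-n)` per
  -- interval, beating the `2 ^ n` intervals; `κ = 1 - ρ` makes the thresholds sum to at most `h`.
  set ρ : ℝ := √(√2)⁻¹ with hρ
  have hs2 : 1 < √2 := by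
    rw [show (1 : ℝ) = √1 by simp]; exact Real.sqrt_lt_sqrt (by norm_num) (by norm_num)
  have hρ0 : 0 < ρ := by positivity
  have hρ4 : ρ ^ 4 = 1 / 2 := by
    rw [show ρ ^ 4 = (ρ ^ 2) ^ 2 by ring, hρ, Real.sq_sqrt (by positivity), inv_pow,
      Real.sq_sqrt (by norm_num)]; norm_num
  have hρ1 : ρ < 1 := by
    by_contra hc
    have : 1 ≤ ρ ^ 4 := one_le_pow₀ (not_lt.1 hc)
    rw [hρ4] at this; norm_num at this
  set κ := 1 - ρ with hκ
  have hκ0 : 0 < κ := by linarith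
  refine ⟨2 * (M * κ⁻¹ ^ p), by positivity, ?_⟩
  intro Ω _ P B hlaw hcont s h hh
  let δ : ℕ → ℝ := fun n => κ * h * ρ ^ n
  have hδ : ∀ n, 0 < δ n := fun n => by positivity
  have hδs : ∀ n, ∑ i ∈ Finset.range (n + 1), δ i ≤ h := by
    intro n
    simp only [δ]
    rw [← Finset.mul_sum]
    have := geom_sum_mul_neg ρ (n + 1)
    have hp : 0 < ρ ^ (n + 1) := by positivity
    nlinarith
  let bad : ℕ → ℕ → Set Ω := fun n j =>
    {ω | δ n < |B (s + (j + 1 : ℕ) / 2 ^ n) ω - B (s + j / 2 ^ n) ω|}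
  have hbad : ∀ n j, P (bad n j) ≤ ENNReal.ofReal (M * κ⁻¹ ^ p * h⁻¹ ^ p * (1 / 4) ^ n) := by
    intro n j
    have hle : s + (j : ℝ) / 2 ^ n ≤ s + (j + 1 : ℕ) / 2 ^ n := by
      push_cast; gcongr; linarith
    have hl := hlaw _ _ hle
    have hdiff : s + ((j + 1 : ℕ) : ℝ) / 2 ^ n - (s + (j : ℝ) / 2 ^ n) = (ρ ^ 2) ^ n * (ρ ^ 2) ^ n := by
      rw [← mul_pow, show ρ ^ 2 * ρ ^ 2 = ρ ^ 4 by ring, hρ4]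
      push_cast; rw [one_div_pow]; ring
    have hnn : (s + ((j + 1 : ℕ) : ℝ) / 2 ^ n - (s + (j : ℝ) / 2 ^ n)).toNNReal =
        ((ρ ^ 2) ^ n).toNNReal ^ 2 := by
      rw [hdiff, Real.toNNReal_mul (by positivity)]; exact (sq _).symm
    rw [hnn] at hl
    have hms : MeasurableSet {x : ℝ | δ n < |x|} := measurableSet_lt measurable_const (by fun_prop)
    have := hl.measure_eq (p := fun x => δ n < |x|) hms
    simp only [bad]
    rw [this]
    refine (hG _ _ (hδ n)).trans (ENNReal.ofReal_le_ofReal ?_)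
    rw [Real.coe_toNNReal _ (by positivity)]
    have e : (ρ ^ 2) ^ n / δ n = κ⁻¹ * h⁻¹ * ρ ^ n := by
      simp only [δ]; rw [← pow_mul, mul_comm 2 n, pow_mul]; field_simp
    rw [e, mul_pow, mul_pow, ← pow_mul, mul_comm n p, pow_mul]
    have : ρ ^ p ≤ 1 / 4 := by
      calc ρ ^ p ≤ ρ ^ 8 := pow_le_pow_of_le_one hρ0.le hρ1.le hp
        _ = (ρ ^ 4) ^ 2 := by ring
        _ = 1 / 4 := by rw [hρ4]; norm_num
    rw [← mul_assoc, ← mul_assoc]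
    gcongr
  have hsub : {ω | ∃ r ∈ Icc s (s + 1), h < |B r ω - B s ω|} ≤ᵐ[P]
      ⋃ n, ⋃ j ∈ Finset.range (2 ^ n), bad n j := by
    filter_upwards [hcont] with ω hω
    rintro ⟨r, hr, hlt⟩
    by_contra hnot
    have hgood : ∀ n j : ℕ, j < 2 ^ n →
        |B (s + (j + 1 : ℕ) / 2 ^ n) ω - B (s + j / 2 ^ n) ω| ≤ δ n := by
      intro n j hj
      by_contra hc
      exact hnot (mem_iUnion.2 ⟨n, mem_iUnion₂.2 ⟨j, Finset.mem_range.2 hj, not_le.1 hc⟩⟩)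
    have hx : Continuous fun u => B (s + u) ω := hω.comp (continuous_const.add continuous_id)
    have := dyadic_dense_Icc (x := fun u => B (s + u) ω) hx (K := h) (fun n j hj =>
      (abs_sub_le_sum_of_dyadic_increments (x := fun u => B (s + u) ω) (fun n => (hδ n).le)
        hgood n j hj).trans (hδs n)) (r := r - s) ⟨by linarith [hr.1], by linarith [hr.2]⟩
    simp only [add_sub_cancel, add_zero] at this
    linarith
  refine (measure_mono_ae hsub).trans ?_
  have hA : 0 ≤ M * κ⁻¹ ^ p * h⁻¹ ^ p := by positivity
  calc P (⋃ n, ⋃ j ∈ Finset.range (2 ^ n), bad n j)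
      ≤ ∑' n, P (⋃ j ∈ Finset.range (2 ^ n), bad n j) := measure_iUnion_le _
    _ ≤ ∑' n : ℕ, ENNReal.ofReal (M * κ⁻¹ ^ p * h⁻¹ ^ p * (1 / 2) ^ n) := by
        refine ENNReal.tsum_le_tsum fun n => ?_
        refine (measure_biUnion_finset_le _ _).trans ?_
        refine (Finset.sum_le_sum fun j _ => hbad n j).trans (le_of_eq ?_)
        rw [Finset.sum_const, Finset.card_range, nsmul_eq_mul,
          show ((2 ^ n : ℕ) : ℝ≥0∞) = ENNReal.ofReal (2 ^ n) by
            rw [ENNReal.ofReal_pow (by norm_num)]; simp,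
          ← ENNReal.ofReal_mul (by positivity)]
        congr 1
        rw [show (1 / 4 : ℝ) = (1 / 2) * (1 / 2) by norm_num, mul_pow]
        have : (2 : ℝ) ^ n * (1 / 2) ^ n = 1 := by rw [← mul_pow]; norm_num
        linear_combination (M * κ⁻¹ ^ p * h⁻¹ ^ p * (1 / 2) ^ n) * this
    _ = ENNReal.ofReal (∑' n : ℕ, M * κ⁻¹ ^ p * h⁻¹ ^ p * (1 / 2) ^ n) :=
        (ENNReal.ofReal_tsum_of_nonneg (fun n => by positivity)
          (summable_geometric_two.mul_left _)).symm
    _ = _ := by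
        rw [tsum_mul_left, tsum_geometric_two]; congr 1; ring

/-! ### Diagonalizing the covariance -/

/-- The map `(x, y) ↦ (x + y, x - y)`. -/
noncomputable def sumDiff : EuclideanSpace ℝ (Fin 2) →L[ℝ] ℝ × ℝ :=
  ContinuousLinearMap.prod (EuclideanSpace.proj 0 + EuclideanSpace.proj 1)
    (EuclideanSpace.proj 0 - EuclideanSpace.proj 1)

lemma sumDiff_apply (x : EuclideanSpace ℝ (Fin 2)) : sumDiff x = (x 0 + x 1, x 0 - x 1) := rfl

lemma posSemidef_correlation {α l : ℝ} (hα : α ∈ Ioo (-1 : ℝ) 1) (hl : 0 ≤ l) :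
    (l • !![1, α; α, 1] : Matrix (Fin 2) (Fin 2) ℝ).PosSemidef := by
  refine .of_dotProduct_mulVec_nonneg ?_ fun x => ?_
  · ext i j
    fin_cases i <;> fin_cases j <;> simp
  · simp [Matrix.mulVec, dotProduct, Fin.sum_univ_two]
    have : x 0 * (l * x 0 + l * α * x 1) + x 1 * (l * α * x 0 + l * x 1) =
        l * ((1 + α) / 2 * (x 0 + x 1) ^ 2 + (1 - α) / 2 * (x 0 - x 1) ^ 2) := by ring
    rw [this]
    have h1 : 0 ≤ (1 + α) / 2 := by linarith [hα.1]
    have h2 : 0 ≤ (1 - α) / 2 := by linarith [hα.2]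
    positivity

/-- The coordinates have equal variances, so their sum and difference are uncorrelated; being
jointly Gaussian, they are independent. -/
lemma multivariateGaussian_map_sumDiff {α l : ℝ} (hα : α ∈ Ioo (-1 : ℝ) 1) (hl : 0 ≤ l) :
    (multivariateGaussian 0 (l • !![1, α; α, 1])).map sumDiff =
      stepLaw ((2 * (1 + α)).toNNReal * l.toNNReal) ((2 * (1 - α)).toNNReal * l.toNNReal) := by
  have hS := posSemidef_correlation hα hl
  set S : Matrix (Fin 2) (Fin 2) ℝ := l • !![1, α; α, 1] with hSdef
  set μ := multivariateGaussian 0 S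
  set X : EuclideanSpace ℝ (Fin 2) → ℝ := fun x => x 0 + x 1
  set Y : EuclideanSpace ℝ (Fin 2) → ℝ := fun x => x 0 - x 1
  have hm : ∀ i : Fin 2, MemLp (fun x : EuclideanSpace ℝ (Fin 2) => x i) 2 μ := fun i =>
    IsGaussian.memLp_dual μ (EuclideanSpace.proj i) 2 (by norm_num)
  have hXe : X = (fun x : EuclideanSpace ℝ (Fin 2) => x 0) + fun x => x 1 := rfl
  have hYe : Y = (fun x : EuclideanSpace ℝ (Fin 2) => x 0) - fun x => x 1 := rfl
  have hc := covariance_eval_multivariateGaussian (μ := (0 : EuclideanSpace ℝ (Fin 2))) hS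
  have hX2 : MemLp X 2 μ := (hm 0).add (hm 1)
  have hY2 : MemLp Y 2 μ := (hm 0).sub (hm 1)
  have c00 : S 0 0 = l := by simp [hSdef]
  have c01 : S 0 1 = l * α := by simp [hSdef]
  have c10 : S 1 0 = l * α := by simp [hSdef]
  have c11 : S 1 1 = l := by simp [hSdef]
  have hXY : cov[X, Y; μ] = 0 := by
    rw [hXe, covariance_add_left (hm 0) (hm 1) hY2, hYe, covariance_sub_right (hm 0) (hm 0) (hm 1),
      covariance_sub_right (hm 1) (hm 0) (hm 1), hc, hc, hc, hc, c00, c01, c10, c11]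
    ring
  have hXX : Var[X; μ] = 2 * (1 + α) * l := by
    rw [← covariance_self hX2.aemeasurable]
    nth_rw 1 [hXe]
    rw [covariance_add_left (hm 0) (hm 1) hX2, hXe, covariance_add_right (hm 0) (hm 0) (hm 1),
      covariance_add_right (hm 1) (hm 0) (hm 1), hc, hc, hc, hc, c00, c01, c10, c11]
    ring
  have hYY : Var[Y; μ] = 2 * (1 - α) * l := by
    rw [← covariance_self hY2.aemeasurable]
    nth_rw 1 [hYe]
    rw [covariance_sub_left (hm 0) (hm 1) hY2, hYe, covariance_sub_right (hm 0) (hm 0) (hm 1),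
      covariance_sub_right (hm 1) (hm 0) (hm 1), hc, hc, hc, hc, c00, c01, c10, c11]
    ring
  have hmean : ∀ L : StrongDual ℝ (EuclideanSpace ℝ (Fin 2)), μ[L] = 0 := fun L => by
    rw [L.integral_comp_id_comm IsGaussian.integrable_id]
    simp [μ]
  have hXlaw : μ.map X = gaussianReal 0 ((2 * (1 + α)).toNNReal * l.toNNReal) := by
    have := IsGaussian.map_eq_gaussianReal (μ := μ)
      (EuclideanSpace.proj 0 + EuclideanSpace.proj 1 : StrongDual ℝ (EuclideanSpace ℝ (Fin 2)))
    rw [hmean] at this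
    rw [← Real.toNNReal_mul (by linarith [hα.1]), ← hXX]
    exact this
  have hYlaw : μ.map Y = gaussianReal 0 ((2 * (1 - α)).toNNReal * l.toNNReal) := by
    have := IsGaussian.map_eq_gaussianReal (μ := μ)
      (EuclideanSpace.proj 0 - EuclideanSpace.proj 1 : StrongDual ℝ (EuclideanSpace ℝ (Fin 2)))
    rw [hmean] at this
    rw [← Real.toNNReal_mul (by linarith [hα.2]), ← hYY]
    exact this
  have hG : HasGaussianLaw (fun x => (X x, Y x)) μ := by
    have := (IsGaussian.hasGaussianLaw_id (μ := μ)).map_of_measurable sumDiff sumDiff.measurable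
    exact this
  have hind := hG.indepFun_of_covariance_eq_zero hXY
  rw [stepLaw, ← hXlaw, ← hYlaw]
  exact (indepFun_iff_map_prod_eq_prod_map_map hX2.aemeasurable hY2.aemeasurable).1 hind

lemma IsTwoSidedCorrelatedBrownian.isDiagonalBrownian {Ω : Type*} [MeasurableSpace Ω] {α : ℝ}
    (hα : α ∈ Ioo (-1 : ℝ) 1) {Z : ℝ → Ω → EuclideanSpace ℝ (Fin 2)} {P : Measure Ω}
    (hZ : IsTwoSidedCorrelatedBrownian α Z P) :
    IsDiagonalBrownian (2 * (1 + α)).toNNReal (2 * (1 - α)).toNNReal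
      (fun t ω => sumDiff (Z t ω)) P where
  indepIncrements := hZ.indepIncrements.map' sumDiff.measurable
  hasLaw_sub s t hst := by
    have h := hZ.hasLaw_sub s t hst
    have hl : 0 ≤ t - s := by linarith
    have := HasLaw.comp (μ := multivariateGaussian 0 ((t - s) • !![1, α; α, 1]))
      ⟨sumDiff.measurable.aemeasurable, multivariateGaussian_map_sumDiff hα hl⟩ h
    simpa only [Function.comp_def, map_sub] using this
  continuous_paths := by
    filter_upwards [hZ.continuous_paths] with ω hω using sumDiff.continuous.comp hω

namespace IsDiagonalBrownian

variable {Ω : Type*} [MeasurableSpace Ω] {a b : ℝ≥0} {W : ℝ → Ω → ℝ × ℝ} {P : Measure Ω}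

lemma hasLaw_fst_sub (hW : IsDiagonalBrownian a b W P) (s t : ℝ) (hst : s ≤ t) :
    HasLaw (fun ω => (W t ω).1 - (W s ω).1) (gaussianReal 0 (a * (t - s).toNNReal)) P :=
  (measurePreserving_fst (μ := gaussianReal 0 (a * (t - s).toNNReal))
    (ν := gaussianReal 0 (b * (t - s).toNNReal))).comp_hasLaw (hW.hasLaw_sub s t hst)

lemma hasLaw_snd_sub (hW : IsDiagonalBrownian a b W P) (s t : ℝ) (hst : s ≤ t) :
    HasLaw (fun ω => (W t ω).2 - (W s ω).2) (gaussianReal 0 (b * (t - s).toNNReal)) P :=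
  (measurePreserving_snd (μ := gaussianReal 0 (a * (t - s).toNNReal))
    (ν := gaussianReal 0 (b * (t - s).toNNReal))).comp_hasLaw (hW.hasLaw_sub s t hst)

end IsDiagonalBrownian

/-! ### From excursions to bridges between integer times -/

/-- The oscillation of a coordinate of the path over `[s, s + 1]` exceeds `h`. -/
def largeOscillation (s h : ℝ) : Set (ℝ → ℝ) := {x | ∃ r ∈ Icc s (s + 1), h < |x r - x s|}

lemma exists_measure_largeOscillation_le (a b : ℝ≥0) (p : ℕ) (hp : 8 ≤ p) :
    ∃ M : ℝ, 0 ≤ M ∧ ∀ (Ω : Type*) [MeasurableSpace Ω] (P : Measure Ω) (W : ℝ → Ω → ℝ × ℝ),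
      IsDiagonalBrownian a b W P → ∀ s h : ℝ, 0 < h →
      P {ω | (fun r => (W r ω).1) ∈ largeOscillation s h ∨
        (fun r => (W r ω).2) ∈ largeOscillation s h} ≤ ENNReal.ofReal (M * h⁻¹ ^ p) := by
  obtain ⟨M₁, hM₁, h₁⟩ := exists_measure_oscillation_le a p hp
  obtain ⟨M₂, hM₂, h₂⟩ := exists_measure_oscillation_le b p hp
  refine ⟨M₁ + M₂, by positivity, fun Ω _ P W hW s h hh => ?_⟩
  rw [add_mul, ENNReal.ofReal_add (by positivity) (by positivity)]
  refine (measure_union_le _ _).trans (add_le_add ?_ ?_)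
  · exact h₁ Ω P (fun r ω => (W r ω).1) hW.hasLaw_fst_sub
      (by filter_upwards [hW.continuous_paths] with ω hω using continuous_fst.comp hω) s h hh
  · exact h₂ Ω P (fun r ω => (W r ω).2) hW.hasLaw_snd_sub
      (by filter_upwards [hW.continuous_paths] with ω hω using continuous_snd.comp hω) s h hh

/-- Cone excursions with prescribed endpoints up to unit length and small terminal displacement
yield approximate cone bridges between integer times, unless the path oscillates a lot. -/
lemma mem_coneBridge_of_isConeExcursion {z : ℝ → EuclideanSpace ℝ (Fin 2)} {s t a b h : ℝ} {L : ℕ}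
    (hs : s ∈ Icc (a - 1) a) (ht : t ∈ Icc b (b + 1)) (hz : IsConeExcursion z s t)
    (hd : terminalDisplacement z s t ≤ 1) (hh : 1 ≤ h) (hL : a + L ≤ b)
    (ho₁ : (fun r => (sumDiff (z r)).1) ∉ largeOscillation (a - 1) h)
    (ho₂ : (fun r => (sumDiff (z r)).2) ∉ largeOscillation (a - 1) h)
    (ho₃ : (fun r => (sumDiff (z r)).1) ∉ largeOscillation b h)
    (ho₄ : (fun r => (sumDiff (z r)).2) ∉ largeOscillation b h) :
    (fun r => sumDiff (z r)) ∈ coneBridge a b (5 * h) L := by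
  simp only [largeOscillation, mem_ofPred_eq, not_exists, not_and, not_lt, sub_add_cancel]
    at ho₁ ho₂ ho₃ ho₄
  obtain ⟨hst, hcone, -⟩ := hz
  obtain ⟨hd1, hd2⟩ := max_le_iff.1 hd
  have ha : a ∈ Icc (a - 1) a := ⟨by linarith, le_rfl⟩
  have a1 := abs_le.1 (ho₁ s hs)
  have a2 := abs_le.1 (ho₂ s hs)
  have a3 := abs_le.1 (ho₁ a ha)
  have a4 := abs_le.1 (ho₂ a ha)
  have a5 := abs_le.1 (ho₃ t ht)
  have a6 := abs_le.1 (ho₄ t ht)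
  simp only [sumDiff_apply] at a1 a2 a3 a4 a5 a6
  obtain ⟨hs1, hs2⟩ := hs
  obtain ⟨ht1, ht2⟩ := ht
  have hL0 : (0 : ℝ) ≤ L := Nat.cast_nonneg L
  obtain ⟨c1, c2⟩ := hcone t ⟨by linarith, le_rfl⟩
  refine ⟨fun j hj => ?_, fun j hj => ?_, ?_, ?_⟩
  · have hj' : (j : ℝ) ≤ L := by exact_mod_cast hj
    have hj0 : (0 : ℝ) ≤ j := Nat.cast_nonneg j
    obtain ⟨e1, e2⟩ := hcone (a + j) ⟨by linarith, by linarith⟩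
    simp only [sumDiff_apply, Prod.fst_sub, Prod.snd_sub]
    rw [abs_le]
    constructor <;> linarith
  -- Backwards from `t`: each coordinate at an intermediate time is at least its value at `s`, hence
  -- at least its value at `t` minus `1`.
  · have hj' : (j : ℝ) ≤ L := by exact_mod_cast hj
    have hj0 : (0 : ℝ) ≤ j := Nat.cast_nonneg j
    obtain ⟨e1, e2⟩ := hcone (b - j) ⟨by linarith, by linarith⟩
    simp only [sumDiff_apply, Prod.fst_sub, Prod.snd_sub]
    rw [abs_le]
    constructor <;> linarith
  -- This comparison uses the full `5h`: `2h` to move between `s` and `a`, `h` between `t` and `b`,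
  -- and `2 ≤ 2h` for the displacement.
  · simp only [sumDiff_apply, Prod.fst_sub]
    rw [abs_le]
    constructor <;> linarith
  · simp only [sumDiff_apply, Prod.snd_sub]
    rw [abs_le]
    constructor <;> linarith

/-- The exponent is `-(2 + ε)` plus the loss `ε * (2 + ε) / 6` from `h`, and this loss is at most `ε
/ 2` as `ε ≤ 1`. -/
lemma coneBridge_bound_le {ε H x : ℝ} {L : ℕ} (hε0 : 0 < ε) (hε1 : ε ≤ 1) (hH : 1 ≤ H)
    (hx : 1 ≤ x) (hL : x / 5 ≤ L) (hL' : 3 * (L : ℝ) ≤ x) :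
    ((5 * (H * x ^ (ε / 12))) ^ (1 + ε) * (L : ℝ) ^ (-((1 + ε) / 2))) ^ 2 *
      ((5 * (H * x ^ (ε / 12))) ^ 2 / (x - 2 * L)) ≤
    (((5 * H) ^ (1 + ε) * 5 ^ ((1 + ε) / 2)) ^ 2 * (75 * H ^ 2)) * x ^ (-(2 + ε / 2)) := by
  have hx0 : 0 < x := by linarith
  have hH0 : 0 < H := by linarith
  have h1 : (5 * (H * x ^ (ε / 12))) ^ (1 + ε) = (5 * H) ^ (1 + ε) * x ^ (ε / 12 * (1 + ε)) := by
    rw [← mul_assoc, Real.mul_rpow (by positivity) (by positivity), ← Real.rpow_mul hx0.le]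
  have h2 : (L : ℝ) ^ (-((1 + ε) / 2)) ≤ 5 ^ ((1 + ε) / 2) * x ^ (-((1 + ε) / 2)) := by
    calc (L : ℝ) ^ (-((1 + ε) / 2)) ≤ (x / 5) ^ (-((1 + ε) / 2)) :=
          Real.rpow_le_rpow_of_nonpos (by positivity) hL (by linarith)
      _ = _ := by
          rw [Real.div_rpow hx0.le (by norm_num), Real.rpow_neg (by norm_num : (0 : ℝ) ≤ 5)]
          field_simp
  have h3 : (5 * (H * x ^ (ε / 12))) ^ 2 / (x - 2 * L) ≤
      75 * H ^ 2 * (x ^ (ε / 12) * x ^ (ε / 12) * x ^ (-1 : ℝ)) := by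
    rw [Real.rpow_neg_one, div_le_iff₀ (by linarith)]
    have : 1 / 3 ≤ x⁻¹ * (x - 2 * L) := by
      rw [inv_mul_eq_div, le_div_iff₀ hx0]; linarith
    calc (5 * (H * x ^ (ε / 12))) ^ 2
        = 75 * H ^ 2 * (x ^ (ε / 12) * x ^ (ε / 12)) * (1 / 3) := by ring
      _ ≤ 75 * H ^ 2 * (x ^ (ε / 12) * x ^ (ε / 12)) * (x⁻¹ * (x - 2 * L)) := by gcongr
      _ = _ := by ring
  have h4 : (x ^ (ε / 12 * (1 + ε)) * x ^ (-((1 + ε) / 2))) ^ 2 *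
      (x ^ (ε / 12) * x ^ (ε / 12) * x ^ (-1 : ℝ)) ≤ x ^ (-(2 + ε / 2)) := by
    rw [sq]
    simp only [← Real.rpow_add hx0]
    exact Real.rpow_le_rpow_of_exponent_le hx (by nlinarith)
  calc _ ≤ ((5 * H) ^ (1 + ε) * x ^ (ε / 12 * (1 + ε)) *
        (5 ^ ((1 + ε) / 2) * x ^ (-((1 + ε) / 2)))) ^ 2 *
        (75 * H ^ 2 * (x ^ (ε / 12) * x ^ (ε / 12) * x ^ (-1 : ℝ))) := by
        rw [h1]
        have : 0 ≤ (5 * (H * x ^ (ε / 12))) ^ 2 / (x - 2 * L) :=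
          div_nonneg (by positivity) (by linarith)
        gcongr
    _ = (((5 * H) ^ (1 + ε) * 5 ^ ((1 + ε) / 2)) ^ 2 * (75 * H ^ 2)) *
        ((x ^ (ε / 12 * (1 + ε)) * x ^ (-((1 + ε) / 2))) ^ 2 *
        (x ^ (ε / 12) * x ^ (ε / 12) * x ^ (-1 : ℝ))) := by ring
    _ ≤ _ := by gcongr

/-! ### Unit time windows and summation -/

/-- The event that there is a cone excursion with terminal displacement at most `1` which starts in
`[-k - 1, -k]` and ends in `[n, n + 1]`. -/
def unitConeExcursionEvent {Ω : Type*} (Z : ℝ → Ω → EuclideanSpace ℝ (Fin 2)) (k n : ℕ) : Set Ω :=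
  {ω | ∃ s t : ℝ, s ∈ Icc (-(k : ℝ) - 1) (-(k : ℝ)) ∧ t ∈ Icc (n : ℝ) (n + 1) ∧
    IsConeExcursion (fun r => Z r ω) s t ∧ terminalDisplacement (fun r => Z r ω) s t ≤ 1}

lemma exists_measure_unitConeExcursionEvent_le {α : ℝ} (hα : α ∈ Ioo (-1 : ℝ) 1) :
    ∃ C ε : ℝ, 0 < C ∧ 0 < ε ∧ ∀ (Ω : Type*) [MeasurableSpace Ω] (P : Measure Ω)
      [IsProbabilityMeasure P] (Z : ℝ → Ω → EuclideanSpace ℝ (Fin 2)),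
      IsTwoSidedCorrelatedBrownian α Z P → ∀ k n : ℕ, 1 ≤ k →
        P (unitConeExcursionEvent Z k n) ≤
          ENNReal.ofReal (C * ((k + n : ℕ) : ℝ) ^ (-(2 + ε))) := by
  obtain ⟨hα1, hα2⟩ := hα
  set a := (2 * (1 + α)).toNNReal with ha
  set b := (2 * (1 - α)).toNNReal with hb
  have ha0 : 0 < a := Real.toNNReal_pos.2 (by linarith)
  have hb0 : 0 < b := Real.toNNReal_pos.2 (by linarith)
  -- Then `ε * a = (1 - α) * (1 + α) / 4 ≤ (1 - α) / 2 = b / 4`.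
  set ε := (1 - α) / 8 with hε
  have hε0 : 0 < ε := by rw [hε]; linarith
  have hε1 : ε ≤ 1 := by rw [hε]; linarith
  have hεab : ε * a ≤ b / 4 := by
    rw [ha, hb, Real.coe_toNNReal _ (by linarith), Real.coe_toNNReal _ (by linarith), hε]
    nlinarith
  obtain ⟨H, C, hH, hC, hbridge⟩ := exists_measure_coneBridge_le ha0 hb0 hε0 hε1 hεab
  -- With `p * ε / 12 ≥ 3`, the oscillation tail `h⁻¹ ^ p` is below `x ^ (-(2 + ε / 2))`.
  obtain ⟨p, hp⟩ := exists_nat_ge (max 8 (36 / ε))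
  have hp8 : 8 ≤ p := by exact_mod_cast (le_max_left _ _).trans hp
  have hpε : 3 ≤ ε / 12 * p := by
    have := (le_max_right _ _).trans hp
    rw [div_le_iff₀ hε0] at this
    linarith
  obtain ⟨M, hM, hosc⟩ := exists_measure_largeOscillation_le a b p hp8
  set K := ((5 * H) ^ (1 + ε) * 5 ^ ((1 + ε) / 2)) ^ 2 * (75 * H ^ 2) with hK
  have hH0 : 0 < H := by linarith
  have hK0 : 0 ≤ K := by positivity
  refine ⟨C * K + 2 * M + 3 ^ (2 + ε / 2), ε / 2, by positivity, by positivity, ?_⟩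
  intro Ω _ P _ Z hZ k n hk
  set m := k + n with hm
  have hm1 : 1 ≤ m := by omega
  set x : ℝ := ((m : ℕ) : ℝ) with hx
  have hx1 : 1 ≤ x := by rw [hx]; exact_mod_cast hm1
  have hx0 : 0 < x := by linarith
  -- For `m < 3` the blocks of length `m / 3` are empty; the summand `3 ^ (2 + ε / 2)` makes the
  -- bound trivial there.
  rcases Nat.lt_or_ge m 3 with hm3 | hm3
  · refine prob_le_one.trans ?_
    rw [← ENNReal.ofReal_one]
    refine ENNReal.ofReal_le_ofReal ?_
    have hx3 : x ≤ 3 := by rw [hx]; exact_mod_cast hm3.le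
    calc (1 : ℝ) = x ^ (2 + ε / 2) * x ^ (-(2 + ε / 2)) := by
          rw [← Real.rpow_add hx0]; simp
      _ ≤ (C * K + 2 * M + 3 ^ (2 + ε / 2)) * x ^ (-(2 + ε / 2)) := by
          have : x ^ (2 + ε / 2) ≤ 3 ^ (2 + ε / 2) := by gcongr
          gcongr
          have : 0 ≤ C * K + 2 * M := by positivity
          linarith
  set L := m / 3 with hL
  have hL1 : 1 ≤ L := by omega
  have hL5 : x / 5 ≤ L := by
    have : m ≤ 5 * L := by omega
    have : x ≤ 5 * L := by rw [hx]; exact_mod_cast this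
    linarith
  have hL3 : 3 * (L : ℝ) ≤ x := by
    have : 3 * L ≤ m := by omega
    rw [hx]; exact_mod_cast this
  set W : ℝ → Ω → ℝ × ℝ := fun t ω => sumDiff (Z t ω)
  have hW : IsDiagonalBrownian a b W P := hZ.isDiagonalBrownian ⟨hα1, hα2⟩
  set h := H * x ^ (ε / 12) with hh
  have hxh : 1 ≤ x ^ (ε / 12) := Real.one_le_rpow hx1 (by positivity)
  have hHh : H ≤ h := le_mul_of_one_le_right hH0.le hxh
  have h1 : 1 ≤ h := hH.trans hHh
  have hxkn : x = n - (-(k : ℝ)) := by rw [hx, hm]; push_cast; ring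
  have hsub : unitConeExcursionEvent Z k n ⊆
      {ω | (fun r => W r ω) ∈ coneBridge (-(k : ℝ)) n (5 * h) L} ∪
      ({ω | (fun r => (W r ω).1) ∈ largeOscillation (-(k : ℝ) - 1) h ∨
        (fun r => (W r ω).2) ∈ largeOscillation (-(k : ℝ) - 1) h} ∪
      {ω | (fun r => (W r ω).1) ∈ largeOscillation n h ∨
        (fun r => (W r ω).2) ∈ largeOscillation n h}) := by
    rintro ω ⟨s, t, hs, ht, hz, hd⟩
    by_contra hnot
    simp only [mem_union, mem_ofPred_eq, not_or] at hnot
    obtain ⟨hn1, ⟨hn2, hn3⟩, hn4, hn5⟩ := hnot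
    exact hn1 (mem_coneBridge_of_isConeExcursion hs ht hz hd h1 (by linarith) hn2 hn3 hn4 hn5)
  have hM' : M * h⁻¹ ^ p ≤ M * x ^ (-(2 + ε / 2)) := by
    gcongr
    calc h⁻¹ ^ p ≤ (x ^ (ε / 12))⁻¹ ^ p := by
          gcongr
          exact le_mul_of_one_le_left (by positivity) hH
      _ = x ^ (-(ε / 12 * p)) := by
          rw [← Real.rpow_neg hx0.le, ← Real.rpow_natCast, ← Real.rpow_mul hx0.le]
          congr 1; ring
      _ ≤ _ := Real.rpow_le_rpow_of_exponent_le hx1 (by linarith)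
  have hB := hbridge Ω P W hW (-(k : ℝ)) n (5 * h) L (by linarith) hL1 (by linarith)
  have hB' : C * ((5 * h) ^ (1 + ε) * (L : ℝ) ^ (-((1 + ε) / 2))) ^ 2 *
      ((5 * h) ^ 2 / (n - (-(k : ℝ)) - 2 * L)) ≤ C * K * x ^ (-(2 + ε / 2)) := by
    rw [← hxkn, mul_assoc, mul_assoc]
    exact mul_le_mul_of_nonneg_left (coneBridge_bound_le hε0 hε1 hH hx1 hL5 hL3) hC.le
  have hO := hosc Ω P W hW
  have h0 : 0 < h := by linarith
  have hxp : 0 < x ^ (-(2 + ε / 2)) := by positivity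
  refine (measure_mono hsub).trans ((measure_union_le _ _).trans
    ((add_le_add (hB.trans (ENNReal.ofReal_le_ofReal hB')) ((measure_union_le _ _).trans
    (add_le_add ((hO _ _ h0).trans (ENNReal.ofReal_le_ofReal hM'))
      ((hO _ _ h0).trans (ENNReal.ofReal_le_ofReal hM'))))).trans ?_))
  rw [← ENNReal.ofReal_add (by positivity) (by positivity),
    ← ENNReal.ofReal_add (by positivity) (by positivity)]
  refine ENNReal.ofReal_le_ofReal ?_
  have : 0 ≤ (3 : ℝ) ^ (2 + ε / 2) * x ^ (-(2 + ε / 2)) := by positivity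
  linarith

/-- Length at least `k + 1` from a start at or after `-k - 1` forces the end time to be nonnegative.
-/
lemma largeConeExcursionEvent_subset {Ω : Type*} (Z : ℝ → Ω → EuclideanSpace ℝ (Fin 2)) (k : ℕ) :
    largeConeExcursionEvent Z k ⊆ ⋃ n : ℕ, unitConeExcursionEvent Z k n := by
  rintro ω ⟨s, t, hs, hz, hlen, hd⟩
  have ht : 0 ≤ t := by linarith [hs.1]
  exact mem_iUnion.2 ⟨⌊t⌋₊, s, t, hs, ⟨Nat.floor_le ht, (Nat.lt_floor_add_one t).le⟩, hz, hd⟩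

theorem proposition3p6 (α : ℝ) (hα : α ∈ Ioo (-1 : ℝ) 1) :
    ∃ c₀ β : ℝ, 0 < c₀ ∧ 1 < β ∧
      ∀ (Ω : Type*) [MeasurableSpace Ω] (P : Measure Ω) [IsProbabilityMeasure P]
        (Z : ℝ → Ω → EuclideanSpace ℝ (Fin 2)), IsTwoSidedCorrelatedBrownian α Z P →
        (∀ k : ℕ, 1 ≤ k → P.real (largeConeExcursionEvent Z k) ≤ c₀ * (k : ℝ) ^ (-β)) ∧
        ∀ᵐ ω ∂P, {k : ℕ | ω ∈ largeConeExcursionEvent Z k}.Finite := by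
  obtain ⟨C, ε, hC, hε, hunit⟩ := exists_measure_unitConeExcursionEvent_le hα
  -- Half of `2 + ε`: one factor `(k + n) ^ (-β)` gives the decay in `k`, the other is summable in
  -- `n`, as `n + 1 ≤ k + n`.
  set β := 1 + ε / 2 with hβ
  have hβ1 : 1 < β := by linarith
  have hs0 : Summable fun n : ℕ => (n : ℝ) ^ (-β) := Real.summable_nat_rpow.2 (by linarith)
  have hs : Summable fun n : ℕ => ((n + 1 : ℕ) : ℝ) ^ (-β) := (summable_nat_add_iff 1).2 hs0
  set S := ∑' n : ℕ, ((n + 1 : ℕ) : ℝ) ^ (-β) with hS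
  have hSpos : 0 < S := hs.tsum_pos (fun n => by positivity) 0 (by positivity)
  refine ⟨C * S, β, by positivity, hβ1, ?_⟩
  intro Ω _ P _ Z hZ
  have hmain : ∀ k : ℕ, 1 ≤ k →
      P (largeConeExcursionEvent Z k) ≤ ENNReal.ofReal (C * S * (k : ℝ) ^ (-β)) := by
    intro k hk
    have hk0 : (0 : ℝ) < k := by exact_mod_cast hk
    calc P (largeConeExcursionEvent Z k)
        ≤ ∑' n, P (unitConeExcursionEvent Z k n) :=
          (measure_mono (largeConeExcursionEvent_subset Z k)).trans (measure_iUnion_le _)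
      _ ≤ ∑' n : ℕ, ENNReal.ofReal (C * (k : ℝ) ^ (-β) * ((n + 1 : ℕ) : ℝ) ^ (-β)) := by
          refine ENNReal.tsum_le_tsum fun n => (hunit Ω P Z hZ k n hk).trans
            (ENNReal.ofReal_le_ofReal ?_)
          have hkn : (0 : ℝ) < ((k + n : ℕ) : ℝ) := by exact_mod_cast (by omega : 0 < k + n)
          have e : ((k + n : ℕ) : ℝ) ^ (-(2 + ε)) =
              ((k + n : ℕ) : ℝ) ^ (-β) * ((k + n : ℕ) : ℝ) ^ (-β) := by
            rw [← Real.rpow_add hkn]; congr 1; rw [hβ]; ring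
          rw [e, mul_assoc]
          have e1 : ((k + n : ℕ) : ℝ) ^ (-β) ≤ (k : ℝ) ^ (-β) :=
            Real.rpow_le_rpow_of_nonpos hk0 (by push_cast; linarith [Nat.cast_nonneg (α := ℝ) n])
              (by linarith)
          have e2 : ((k + n : ℕ) : ℝ) ^ (-β) ≤ ((n + 1 : ℕ) : ℝ) ^ (-β) :=
            Real.rpow_le_rpow_of_nonpos (by positivity)
              (by exact_mod_cast (by omega : n + 1 ≤ k + n)) (by linarith)
          gcongr
      _ = ENNReal.ofReal (∑' n : ℕ, C * (k : ℝ) ^ (-β) * ((n + 1 : ℕ) : ℝ) ^ (-β)) :=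
          (ENNReal.ofReal_tsum_of_nonneg (fun n => by positivity) (hs.mul_left _)).symm
      _ = _ := by rw [tsum_mul_left, ← hS]; congr 1; ring
  refine ⟨fun k hk => ENNReal.toReal_le_of_le_ofReal (by positivity) (hmain k hk), ?_⟩
  -- Borel–Cantelli; the term `k = 0`, not covered by the bound, is split off.
  refine ae_finite_setOfPred_mem (μ := P) (s := largeConeExcursionEvent Z) ?_
  rw [tsum_eq_zero_add' ENNReal.summable]
  refine ENNReal.add_ne_top.2 ⟨measure_ne_top _ _, ne_top_of_le_ne_top ?_
    (ENNReal.tsum_le_tsum fun k => hmain (k + 1) (by omega))⟩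
  rw [← ENNReal.ofReal_tsum_of_nonneg (fun n => by positivity) (hs.mul_left _)]
  exact ENNReal.ofReal_ne_top
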